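/- **Definitions.** Unit squares of the plane are indexed by column (from the left) and row (from the bottom). A Ferrers board in the $n\times n$ array is a set $F$ of squares of the array that contains, with each square, all squares weakly to the left of and weakly below it; its border is the lattice path from $(0,n)$ to $(n,0)$ with steps $(1,0)$ and $(0,-1)$ that bounds $F$ from above. Let $\mathcal F_n$ be the set of Ferrers boards with $n$ non-empty rows and $n$ non-empty columns whose border stays weakly above the line $x+y=n$. The height of a border vertex $(x,y)$ is $x+y-n$; the height of the border is the maximum of the heights of its vertices; $\eta(F)$ is the number of border vertices of height $2$. Let $\mathcal M_n$ be the set of perfect matchings of $\{1,\dots,2n\}$, written as sets of pairs $(i,j)$ with $i<j$; $i$ is called an opener and $j$ a closer. Reading $1,\dots,2n$ in order, with a step $(1,0)$ for each opener and a step $(0,-1)$ for each closer, gives a path from $(0,n)$ to $(n,0)$, the border of a board $F\in\mathcal F_n$ called the shape of the matching. Its columns correspond to the openers and its rows to the closers; let $R$ be the set of squares (rooks) lying in the column of $i$ and the row of $j$ for the pairs $(i,j)$ of the matching. The matching avoids a permutation $\tau$ of $\{1,\dots,k\}$ if for every vertex $(a,b)$ of the border of $F$ the rooks in $[0,a]\times[0,b]$,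 read from left to right by their rows, have no subsequence order-isomorphic to $\tau(1)\cdots\tau(k)$. Let $\mathcal M_n(\sigma,\tau)$ be the set of matchings in $\mathcal M_n$ that avoid both $\sigma$ and $\tau$, and $\mathcal M_F(\sigma,\tau)$ the set of those of shape $F$. The arcs of a set partition of $\{1,\dots,n\}$ are the pairs $(i,j)$ with $i<j$ consecutive elements of a block. The partition avoids $\tau$ if there are no $1\le i_1<\dots<i_{2k}\le n$ such that all the pairs $(i_a,i_{2k+1-\tau(a)})$, $1\le a\le k$, are arcs. Let $\mathcal P_n(\sigma,\tau)$ be the set of partitions of $\{1,\dots,n\}$ avoiding both $\sigma$ and $\tau$. **Theorem.** For all $n\ge 0$ and all $F\in\mathcal F_n$, $$|\mathcal M_F(123,321)|=\begin{cases}2^{\eta(F)}&\text{if the border of }F\text{ has height less than }5,\\0&\text{otherwise.}\end{cases}$$ Moreover, $$\sum_{n\ge0}|\mathcal M_n(123,321)|z^n=\frac{1-5z+2z^2}{1-6z+5z^2},\qquad |\mathcal M_n(123,321)|=\frac{5^{n-1}+1}{2}\quad\text{for all }n\ge1,$$ and $$\sum_{n\ge0}|\mathcal P_n(123,321)|z^n=\frac{1-10z+32z^2-37z^3+12z^4}{(1-z)(1-10z+31z^2-30z^3+z^4)}$$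 as formal power series. -/

import Mathlib

/-! Squares are recorded by their lower left corner: `(x, y) : ℕ × ℕ` is the unit square in column
`x` (counted from the left) and row `y` (counted from the bottom), both starting from `0`.
Lattice points are also elements of `ℕ × ℕ`.  Patterns are permutations of `Fin k`. -/

namespace FerrersMatching

/-- `Γ(V)`: the unit squares inside the rectangle `[0, a] × [0, b]`, for a vertex `V = (a, b)`. -/
def Gam (V : ℕ × ℕ) : Finset (ℕ × ℕ) := Finset.range V.1 ×ˢ Finset.range V.2

/-- The vertices of the border of a Ferrers board `F` in the `n × n` array, i.e. of the lattice path
from `(0, n)` to `(n, 0)` bounding `F`: a lattice point `V = (a, b)` of `[0, n] × [0, n]` is on this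
path iff everything to its lower left is in `F` and the square to its upper right is not. -/
def border (n : ℕ) (F : Finset (ℕ × ℕ)) : Finset (ℕ × ℕ) :=
  {V ∈ Finset.range (n + 1) ×ˢ Finset.range (n + 1) | Gam V ⊆ F ∧ V ∉ F}

/-- `F_n`: the Ferrers boards with `n` non-empty rows and `n` non-empty columns whose border stays
weakly above the line `y = n - x`. -/
structure IsBoard (n : ℕ) (F : Finset (ℕ × ℕ)) : Prop where
  subset_square : F ⊆ Gam (n, n)
  lower : IsLowerSet (F : Set (ℕ × ℕ))
  column_nonempty : ∀ x < n, ∃ y, (x, y) ∈ F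
  row_nonempty : ∀ y < n, ∃ x, (x, y) ∈ F
  border_above : ∀ V ∈ border n F, n ≤ V.1 + V.2

/-- The height of a border vertex: its distance to the line `y = n - x`, starting from `0` at
`(0, n)`, increasing by `1` with every east step and decreasing by `1` with every south step. -/
def vertexHeight (n : ℕ) (V : ℕ × ℕ) : ℕ := V.1 + V.2 - n

/-- The height of the border of `F`, i.e. the maximal height of its vertices. -/
def borderHeight (n : ℕ) (F : Finset (ℕ × ℕ)) : ℕ := (border n F).sup (vertexHeight n)

/-- `η(F)`: the number of border vertices of height `2`. -/
def eta (n : ℕ) (F : Finset (ℕ × ℕ)) : ℕ := {V ∈ border n F | vertexHeight n V = 2}.card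

/-- The permutation given by a set `S` of rooks, no two in a row or column, contains the
pattern `τ`. -/
def RooksContain (S : Finset (ℕ × ℕ)) {k : ℕ} (τ : Equiv.Perm (Fin k)) : Prop :=
  ∃ x y : Fin k → ℕ, StrictMono x ∧ (∀ a, (x a, y a) ∈ S) ∧ ∀ a b, y a < y b ↔ τ a < τ b

/-- The rook placement `(R, F)` avoids `τ`: for every vertex `V` of the border of `F`, the
permutation given by `R ∩ Γ(V)` avoids `τ`. -/
def PlacementAvoids (n : ℕ) (R F : Finset (ℕ × ℕ)) {k : ℕ} (τ : Equiv.Perm (Fin k)) : Prop :=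
  ∀ V ∈ border n F, ¬ RooksContain (R ∩ Gam V) τ

/-- A perfect matching on `2 n` points, as the set of its pairs `(i, j)`, `i < j`: each point
appears in exactly one of the pairs. -/
structure IsMatching (n : ℕ) (M : Finset (Fin (2 * n) × Fin (2 * n))) : Prop where
  lt : ∀ e ∈ M, e.1 < e.2
  existsUnique : ∀ v, ∃! e, e ∈ M ∧ (e.1 = v ∨ e.2 = v)

/-- The vertex of the lattice path of a matching reached from `(0, n)` after reading the first `t`
points, with an east step for every opener and a south step for every closer. -/
def pathVertex (n : ℕ) (M : Finset (Fin (2 * n) × Fin (2 * n))) (t : ℕ) : ℕ × ℕ :=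
  ((M.filter fun e => (e.1 : ℕ) < t).card, n - (M.filter fun e => (e.2 : ℕ) < t).card)

/-- The shape of a matching: the board consisting of the squares below its path. -/
def shape (n : ℕ) (M : Finset (Fin (2 * n) × Fin (2 * n))) : Finset (ℕ × ℕ) :=
  (Finset.range (2 * n + 1)).biUnion fun t => Gam (pathVertex n M t)

/-- The rooks of the placement associated with a matching: for every pair `(i, j)` a rook in the
column below the east step of `i` and the row to the left of the south step of `j`. -/
def rooks (n : ℕ) (M : Finset (Fin (2 * n) × Fin (2 * n))) : Finset (ℕ × ℕ) :=
  M.image fun e => ((pathVertex n M e.1).1, (pathVertex n M (e.2 + 1)).2)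

/-- A matching avoids `τ` iff the associated rook placement does. -/
def MatchingAvoids (n : ℕ) (M : Finset (Fin (2 * n) × Fin (2 * n))) {k : ℕ}
    (τ : Equiv.Perm (Fin k)) : Prop :=
  PlacementAvoids n (rooks n M) (shape n M) τ

/-- `M_n(σ, τ)`: the matchings on `2 n` points that avoid `σ` and `τ`. -/
def matchingsAvoiding (n : ℕ) {k l : ℕ} (σ : Equiv.Perm (Fin k)) (τ : Equiv.Perm (Fin l)) :
    Set (Finset (Fin (2 * n) × Fin (2 * n))) :=
  {M | IsMatching n M ∧ MatchingAvoids n M σ ∧ MatchingAvoids n M τ}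

/-- `M_F(σ, τ)`: the matchings of shape `F` that avoid `σ` and `τ`. -/
def matchingsOfShapeAvoiding (n : ℕ) (F : Finset (ℕ × ℕ)) {k l : ℕ} (σ : Equiv.Perm (Fin k))
    (τ : Equiv.Perm (Fin l)) : Set (Finset (Fin (2 * n) × Fin (2 * n))) :=
  {M | M ∈ matchingsAvoiding n σ τ ∧ shape n M = F}

/-- `(i, j)` is an arc of the set partition `P`: `i < j` are consecutive elements of a block. -/
def IsArc {n : ℕ} (P : Finpartition (Finset.univ : Finset (Fin n))) (i j : Fin n) : Prop :=
  i < j ∧ ∃ B ∈ P.parts, i ∈ B ∧ j ∈ B ∧ ∀ l ∈ B, ¬ (i < l ∧ l < j)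

/-- The set partition `P` avoids `τ`: there are no `2 k` points `i_1 < ⋯ < i_{2k}` such that
`P` contains the arcs `(i_a, i_{2k+1-τ(a)})` for `1 ≤ a ≤ k`. -/
def PartitionAvoids {n : ℕ} (P : Finpartition (Finset.univ : Finset (Fin n))) {k : ℕ}
    (τ : Equiv.Perm (Fin k)) : Prop :=
  ¬ ∃ i : Fin (k + k) → Fin n, StrictMono i ∧
    ∀ a : Fin k, IsArc P (i (Fin.castAdd k a)) (i (Fin.rev (Fin.castAdd k (τ a))))

/-- `P_n(σ, τ)`: the partitions of a set of `n` points that avoid `σ` and `τ`. -/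
def partitionsAvoiding (n : ℕ) {k l : ℕ} (σ : Equiv.Perm (Fin k)) (τ : Equiv.Perm (Fin l)) :
    Set (Finpartition (Finset.univ : Finset (Fin n))) :=
  {P | PartitionAvoids P σ ∧ PartitionAvoids P τ}

/-- The pattern `123`. -/
def p123 : Equiv.Perm (Fin 3) := Equiv.refl (Fin 3)

/-- The pattern `321`. -/
def p321 : Equiv.Perm (Fin 3) := Fin.revPerm

end FerrersMatching

/-! A matching or a partition is recorded by its arcs. Then 123 means three mutually nested arcs and
321 three mutually crossing ones, so the task is to count arc diagrams without either, for
prescribed openers and closers.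

Scan the points from left to right. The `h` arcs open at a given moment form a permutation: their
openers, read in the order of their closers. It has no monotone subsequence of length three. A new
opener is a new maximum of this permutation, and it may enter at a place exactly when the entries
before that place decrease and the entries after it increase (`Insertable`). For `h = 2, 3` the
number of such places varies with the permutation, but its average does not: in exactly half of the
diagrams the last two entries ascend. `Census` carries this equidistribution through the scan, and
the average factors are 1, 2, 2, 1 for `h = 0, 1, 2, 3` and 0 from `h = 4` on (`growth`). A closer
involves no choice, since the set of later closers is arbitrary throughout. Hence the number of
diagrams is a product of factors that depend only on the heights (`card_diagrams`).

Along a path of height less than 5 the factor 2 arises at the steps from height 1 to 2 and from 2 to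
3. Pairing each step from 2 to 3 with the following step from 3 to 2 leaves one factor 2 for every
vertex of height 2 (`weight_eq_two_pow`).

Summing over all words gives a transfer matrix on the heights 0 to 4. For matchings, two steps at a
time act on the heights 0, 2, 4 with eigenvalues 0, 1, 5. For partitions, where a point may be an
opener, a closer, both or neither, the matrix is tridiagonal and Cramer's rule yields the series. -/

namespace FerrersMatching

/-! ### Sparse arc diagrams and removal of the last opener -/

/-- `A` is a set of arcs `(i, j)`, `i < j`, matching the openers `O` bijectively with the
closers `C`. -/
structure IsDiagram (O C : Finset ℕ) (A : Finset (ℕ × ℕ)) : Prop where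
  mem : ∀ i j, (i, j) ∈ A → i ∈ O ∧ j ∈ C ∧ i < j
  right : ∀ i ∈ O, ∃ j, (i, j) ∈ A
  left : ∀ j ∈ C, ∃ i, (i, j) ∈ A
  right_unique : ∀ i j k, (i, j) ∈ A → (i, k) ∈ A → j = k
  left_unique : ∀ i j k, (i, k) ∈ A → (j, k) ∈ A → i = j

/-- A set of arcs without three mutually crossing and without three mutually nested arcs. -/
structure IsSparse (A : Finset (ℕ × ℕ)) : Prop where
  noCrossing : ∀ i₁ i₂ i₃ j₁ j₂ j₃, i₁ < i₂ → i₂ < i₃ → i₃ < j₁ → j₁ < j₂ → j₂ < j₃ →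
    (i₁, j₁) ∈ A → (i₂, j₂) ∈ A → (i₃, j₃) ∉ A
  noNesting : ∀ i₁ i₂ i₃ j₁ j₂ j₃, i₁ < i₂ → i₂ < i₃ → i₃ < j₁ → j₁ < j₂ → j₂ < j₃ →
    (i₁, j₃) ∈ A → (i₂, j₂) ∈ A → (i₃, j₁) ∉ A

open Classical in
/-- The sparse diagrams with openers `O` and closers `C`. -/
noncomputable def diagrams (O C : Finset ℕ) : Finset (Finset (ℕ × ℕ)) :=
  (O ×ˢ C).powerset.filter fun A => IsDiagram O C A ∧ IsSparse A

theorem mem_diagrams {O C : Finset ℕ} {A : Finset (ℕ × ℕ)} :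
    A ∈ diagrams O C ↔ IsDiagram O C A ∧ IsSparse A := by
  simp only [diagrams, Finset.mem_filter, Finset.mem_powerset, and_iff_right_iff_imp]
  rintro ⟨h, -⟩ ⟨i, j⟩ hij
  exact Finset.mem_product.2 ⟨(h.mem i j hij).1, (h.mem i j hij).2.1⟩

/-- The arcs ending in `d` and `e` begin in increasing order. -/
def Asc (d e : ℕ) (A : Finset (ℕ × ℕ)) : Prop := ∃ i j, i < j ∧ (i, d) ∈ A ∧ (j, e) ∈ A

/-- The arc `(t, e)`, beginning after all arcs of `A`, completes no triple crossing or nesting. -/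
def Insertable (t e : ℕ) (A : Finset (ℕ × ℕ)) : Prop :=
  ∀ i₁ i₂ j₁ j₂, (i₁, j₁) ∈ A → (i₂, j₂) ∈ A → j₁ < j₂ → t < j₁ →
    (j₂ < e → i₂ < i₁) ∧ (e < j₁ → i₁ < i₂)

/-- The new arc begins last, so in a forbidden triple it can only be the last arc of a crossing or
the innermost arc of a nesting. `Insertable` excludes these two cases. -/
theorem insert_mem_diagrams {O C : Finset ℕ} {A : Finset (ℕ × ℕ)} {t e : ℕ}
    (hO : ∀ i ∈ O, i < t) (he : e ∈ C) (hte : t < e) (hA : A ∈ diagrams O (C.erase e))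
    (hi : Insertable t e A) : insert (t, e) A ∈ diagrams (insert t O) C := by
  rw [mem_diagrams] at hA ⊢
  obtain ⟨⟨h1, h2, h3, h4, h5⟩, h6, h7⟩ := hA
  refine ⟨⟨?_, ?_, ?_, ?_, ?_⟩, ?_, ?_⟩
  · clear h6 h7
    grind
  · intro i hi
    rcases Finset.mem_insert.1 hi with rfl | hi
    · exact ⟨e, Finset.mem_insert_self _ _⟩
    · exact (h2 i hi).imp fun j hj => Finset.mem_insert_of_mem hj
  · intro j hj
    rcases eq_or_ne j e with rfl | hne
    · exact ⟨t, Finset.mem_insert_self _ _⟩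
    · exact (h3 j (Finset.mem_erase.2 ⟨hne, hj⟩)).imp fun i hi => Finset.mem_insert_of_mem hi
  · clear h6 h7
    grind
  · clear h6 h7
    grind
  · intro i₁ i₂ i₃ j₁ j₂ j₃ a b c d f g h k
    simp only [Finset.mem_insert, Prod.mk.injEq] at g h k
    have := hi i₁ i₂ j₁ j₂
    grind
  · intro i₁ i₂ i₃ j₁ j₂ j₃ a b c d f g h k
    simp only [Finset.mem_insert, Prod.mk.injEq] at g h k
    -- In a nesting the outer arc has the later end, hence the swapped openers.
    have := hi i₂ i₁ j₂ j₃
    grind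

theorem erase_mem_diagrams {O C : Finset ℕ} {B : Finset (ℕ × ℕ)} {t e : ℕ}
    (hO : ∀ i ∈ O, i < t) (hB : B ∈ diagrams (insert t O) C) (hte : (t, e) ∈ B) :
    B.erase (t, e) ∈ diagrams O (C.erase e) ∧ Insertable t e (B.erase (t, e)) := by
  rw [mem_diagrams] at hB ⊢
  obtain ⟨⟨h1, h2, h3, h4, h5⟩, h6, h7⟩ := hB
  have ht : t < e := (h1 _ _ hte).2.2
  have htO : t ∉ O := fun h => (hO t h).false
  have h1' : ∀ i j, (i, j) ∈ B.erase (t, e) → i ∈ O ∧ j ∈ C.erase e ∧ i < j := by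
    intro i j hij
    obtain ⟨hne, hij⟩ := Finset.mem_erase.1 hij
    have hj : j ≠ e := fun h => hne (by rw [h, h5 i t e (h ▸ hij) hte])
    have hi : i ≠ t := fun h => hne (by rw [h, h4 t j e (h ▸ hij) hte])
    obtain ⟨a, b, c⟩ := h1 i j hij
    exact ⟨(Finset.mem_insert.1 a).resolve_left hi, Finset.mem_erase.2 ⟨hj, b⟩, c⟩
  refine ⟨⟨⟨h1', ?_, ?_, ?_, ?_⟩, ⟨?_, ?_⟩⟩, ?_⟩
  · intro i hi
    obtain ⟨j, hj⟩ := h2 i (Finset.mem_insert_of_mem hi)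
    exact ⟨j, Finset.mem_erase.2 ⟨by rintro ⟨⟩; exact htO hi, hj⟩⟩
  · intro j hj
    obtain ⟨hne, hj⟩ := Finset.mem_erase.1 hj
    obtain ⟨i, hi⟩ := h3 j hj
    exact ⟨i, Finset.mem_erase.2 ⟨fun h => hne (Prod.ext_iff.1 h).2, hi⟩⟩
  · exact fun i j k g h => h4 i j k (Finset.mem_of_mem_erase g) (Finset.mem_of_mem_erase h)
  · exact fun i j k g h => h5 i j k (Finset.mem_of_mem_erase g) (Finset.mem_of_mem_erase h)
  · intro i₁ i₂ i₃ j₁ j₂ j₃ a b c d f g h k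
    exact h6 i₁ i₂ i₃ j₁ j₂ j₃ a b c d f (Finset.mem_of_mem_erase g)
      (Finset.mem_of_mem_erase h) (Finset.mem_of_mem_erase k)
  · intro i₁ i₂ i₃ j₁ j₂ j₃ a b c d f g h k
    exact h7 i₁ i₂ i₃ j₁ j₂ j₃ a b c d f (Finset.mem_of_mem_erase g)
      (Finset.mem_of_mem_erase h) (Finset.mem_of_mem_erase k)
  · intro i₁ i₂ j₁ j₂ g h hj ht1
    have e1 := h1' _ _ g
    have e2 := h1' _ _ h
    have g' := Finset.mem_of_mem_erase g
    have h' := Finset.mem_of_mem_erase h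
    have l1 := hO _ e1.1
    have l2 := hO _ e2.1
    have hne : i₁ ≠ i₂ := by
      rintro rfl
      exact hj.ne (h4 _ _ _ g' h')
    refine ⟨fun hl => ?_, fun hl => ?_⟩
    · by_contra hc
      exact h6 i₁ i₂ t j₁ j₂ e (by omega) l2 ht1 hj hl g' h' hte
    · by_contra hc
      exact h7 i₂ i₁ t e j₁ j₂ (by omega) l1 ht hl hj h' g' hte

open Classical in
/-- Deleting the arc of the last opener. -/
theorem card_filter_diagrams_insert {O C : Finset ℕ} {t : ℕ} (hO : ∀ i ∈ O, i < t)
    (Q : Finset (ℕ × ℕ) → Prop) [DecidablePred Q] :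
    ((diagrams (insert t O) C).filter Q).card = ∑ e ∈ C.filter (t < ·),
      ((diagrams O (C.erase e)).filter fun A => Insertable t e A ∧ Q (insert (t, e) A)).card := by
  have htA : ∀ (e x : ℕ) A, A ∈ diagrams O (C.erase e) → (t, x) ∉ A := by
    intro e x A hA h
    exact (hO _ ((mem_diagrams.1 hA).1.mem _ _ h).1).false
  have key : (diagrams (insert t O) C).filter Q = (C.filter (t < ·)).biUnion fun e =>
      ((diagrams O (C.erase e)).filter fun A => Insertable t e A ∧ Q (insert (t, e) A)).image
        (insert (t, e)) := by
    ext B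
    simp only [Finset.mem_filter, Finset.mem_biUnion, Finset.mem_image]
    constructor
    · rintro ⟨hB, hQ⟩
      obtain ⟨e, he⟩ := (mem_diagrams.1 hB).1.right t (Finset.mem_insert_self _ _)
      obtain ⟨-, heC, hte⟩ := (mem_diagrams.1 hB).1.mem _ _ he
      have := erase_mem_diagrams hO hB he
      exact ⟨e, ⟨heC, hte⟩, B.erase (t, e), ⟨this.1, this.2, by rwa [Finset.insert_erase he]⟩,
        Finset.insert_erase he⟩
    · rintro ⟨e, ⟨heC, hte⟩, A, ⟨hA, hi, hQ⟩, rfl⟩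
      exact ⟨insert_mem_diagrams hO heC hte hA hi, hQ⟩
  rw [key, Finset.card_biUnion]
  · refine Finset.sum_congr rfl fun e _ => Finset.card_image_of_injOn ?_
    intro A hA B hB hAB
    have hA' := htA e e A (Finset.mem_filter.1 (Finset.mem_coe.1 hA)).1
    have hB' := htA e e B (Finset.mem_filter.1 (Finset.mem_coe.1 hB)).1
    simpa [Finset.erase_insert hA', Finset.erase_insert hB'] using
      congrArg (fun S => Finset.erase S (t, e)) hAB
  · intro e _ f _ hef
    rw [Function.onFun, Finset.disjoint_left]
    intro B hB hB'
    obtain ⟨A, hA, rfl⟩ := Finset.mem_image.1 hB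
    obtain ⟨A', hA', h⟩ := Finset.mem_image.1 hB'
    have : (t, e) ∈ insert (t, f) A' := by rw [h]; exact Finset.mem_insert_self _ _
    rcases Finset.mem_insert.1 this with h1 | h1
    · exact hef (Prod.ext_iff.1 h1).2
    · exact htA f e A' (Finset.mem_filter.1 hA').1 h1

/-- An arc that ends at or before `t` begins strictly before `t`, hence the shift by one between the
two sides. -/
theorem IsDiagram.card_closers_le {O C : Finset ℕ} {A : Finset (ℕ × ℕ)} (h : IsDiagram O C A)
    (t : ℕ) : (C.filter (· < t + 1)).card ≤ (O.filter (· < t)).card := by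
  choose! f hf using h.left
  refine Finset.card_le_card_of_injOn f ?_ ?_
  · intro j hj
    simp only [Finset.coe_filter, Set.mem_ofPred_eq] at hj ⊢
    have := h.mem _ _ (hf j hj.1)
    exact ⟨this.1, by omega⟩
  · intro j hj k hk hjk
    simp only [Finset.coe_filter, Set.mem_ofPred_eq] at hj hk
    exact h.right_unique (f j) j k (hf j hj.1) (hjk ▸ hf k hk.1)

theorem IsDiagram.card_openers_le {O C : Finset ℕ} {A : Finset (ℕ × ℕ)} (h : IsDiagram O C A) :
    O.card ≤ C.card := by
  choose! f hf using h.right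
  refine Finset.card_le_card_of_injOn f (fun i hi => (h.mem _ _ (hf i hi)).2.1) ?_
  intro j hj k hk hjk
  exact h.left_unique _ _ _ (hf j hj) (hjk ▸ hf k hk)

/-! ### The permutation formed by the open arcs -/

/-- The opener of the arc of `A` that ends in `j`. -/
def opener (A : Finset (ℕ × ℕ)) (j : ℕ) : ℕ := (A.filter fun p => p.2 = j).sup Prod.fst

theorem IsDiagram.opener_eq {O C : Finset ℕ} {A : Finset (ℕ × ℕ)} (h : IsDiagram O C A)
    {i j : ℕ} (hij : (i, j) ∈ A) : opener A j = i := by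
  have : A.filter (fun p => p.2 = j) = {(i, j)} := by
    ext ⟨a, b⟩
    simp only [Finset.mem_filter, Finset.mem_singleton, Prod.mk.injEq]
    constructor
    · rintro ⟨hab, rfl⟩
      exact ⟨h.left_unique _ _ _ hab hij, rfl⟩
    · rintro ⟨rfl, rfl⟩
      exact ⟨hij, rfl⟩
  simp [opener, this]

theorem IsDiagram.mem_iff {O C : Finset ℕ} {A : Finset (ℕ × ℕ)} (h : IsDiagram O C A)
    {i j : ℕ} : (i, j) ∈ A ↔ j ∈ C ∧ opener A j = i := by
  refine ⟨fun hij => ⟨(h.mem _ _ hij).2.1, h.opener_eq hij⟩, ?_⟩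
  rintro ⟨hj, rfl⟩
  obtain ⟨i, hi⟩ := h.left j hj
  rwa [h.opener_eq hi]

theorem IsDiagram.asc_iff {O C : Finset ℕ} {A : Finset (ℕ × ℕ)} (h : IsDiagram O C A)
    {d e : ℕ} (hd : d ∈ C) (he : e ∈ C) : Asc d e A ↔ opener A d < opener A e := by
  simp [Asc, h.mem_iff, hd, he]

theorem IsDiagram.opener_ne {O C : Finset ℕ} {A : Finset (ℕ × ℕ)} (h : IsDiagram O C A)
    {d e : ℕ} (hd : d ∈ C) (he : e ∈ C) (hne : d ≠ e) : opener A d ≠ opener A e := by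
  intro hde
  exact hne (h.right_unique (opener A d) d e (h.mem_iff.2 ⟨hd, rfl⟩) (h.mem_iff.2 ⟨he, hde.symm⟩))

/-- Arcs with ends in `E` begin before `t` and end after it, so they are all open at `t`. Three of
them with monotone openers would cross or nest mutually. -/
theorem not_monotone {O C E : Finset ℕ} {A : Finset (ℕ × ℕ)} {t : ℕ}
    (hA : A ∈ diagrams O (C ∪ E)) (hO : ∀ i ∈ O, i < t) (hE : ∀ x ∈ E, t < x) {a b c : ℕ}
    (ha : a ∈ E) (hb : b ∈ E) (hc : c ∈ E) (hab : a < b) (hbc : b < c) :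
    ¬ (opener A a < opener A b ∧ opener A b < opener A c) ∧
    ¬ (opener A c < opener A b ∧ opener A b < opener A a) := by
  obtain ⟨h, h'⟩ := mem_diagrams.1 hA
  have m : ∀ x ∈ E, (opener A x, x) ∈ A := fun x hx =>
    h.mem_iff.2 ⟨Finset.mem_union_right _ hx, rfl⟩
  have l : ∀ x ∈ E, opener A x < a := fun x hx =>
    (hO _ (h.mem _ _ (m x hx)).1).trans (hE a ha)
  exact ⟨fun k => h'.noCrossing _ _ _ a b c k.1 k.2 (l c hc) hab hbc (m a ha) (m b hb) (m c hc),
    fun k => h'.noNesting _ _ _ a b c k.1 k.2 (l a ha) hab hbc (m c hc) (m b hb) (m a ha)⟩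

/-- Only arcs still open after `t` matter, and those are the ones ending in `E`. -/
theorem insertable_iff {O C E : Finset ℕ} {A : Finset (ℕ × ℕ)} {t e : ℕ}
    (hA : A ∈ diagrams O (C ∪ E)) (hC : ∀ j ∈ C, j ≤ t) (hE : ∀ x ∈ E, t < x) :
    Insertable t e A ↔ ∀ a ∈ E, ∀ b ∈ E, a < b →
      (b < e → opener A b < opener A a) ∧ (e < a → opener A a < opener A b) := by
  have h := (mem_diagrams.1 hA).1
  simp only [Insertable, h.mem_iff, Finset.mem_union]
  constructor
  · intro k a ha b hb hab
    exact k _ _ a b ⟨Or.inr ha, rfl⟩ ⟨Or.inr hb, rfl⟩ hab (hE a ha)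
  · rintro k _ _ a b ⟨ha, rfl⟩ ⟨hb, rfl⟩ hab hta
    have ha' : a ∈ E := ha.resolve_left fun h => (hC a h).not_gt hta
    have hb' : b ∈ E := hb.resolve_left fun h => (hC b h).not_gt (hta.trans hab)
    exact k a ha' b hb' hab

theorem asc_insert_of_ne {A : Finset (ℕ × ℕ)} {t x d e : ℕ} (hd : d ≠ x) (he : e ≠ x) :
    Asc d e (insert (t, x) A) ↔ Asc d e A := by
  simp [Asc, hd, he]

theorem not_asc_insert {O C : Finset ℕ} {A : Finset (ℕ × ℕ)} {t x e : ℕ}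
    (hA : A ∈ diagrams O (C.erase x)) (hO : ∀ i ∈ O, i < t) (he : x ≠ e) :
    ¬ Asc x e (insert (t, x) A) := by
  have h := (mem_diagrams.1 hA).1
  rintro ⟨i, j, hij, hi, hj⟩
  have hj' : (j, e) ∈ A := by simpa [he.symm] using hj
  have hi' : i = t := by
    rcases Finset.mem_insert.1 hi with hi | hi
    · exact congrArg Prod.fst hi
    · exact absurd (h.mem _ _ hi).2.1 (Finset.notMem_erase _ _)
  have := hO j (h.mem _ _ hj').1
  omega

theorem asc_insert {O C : Finset ℕ} {A : Finset (ℕ × ℕ)} {t x d : ℕ}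
    (hA : A ∈ diagrams O C) (hO : ∀ i ∈ O, i < t) (hd : d ∈ C) :
    Asc d x (insert (t, x) A) := by
  have h := (mem_diagrams.1 hA).1
  obtain ⟨i, hi⟩ := h.left d hd
  exact ⟨i, t, hO i (h.mem _ _ hi).1, Finset.mem_insert_of_mem hi, Finset.mem_insert_self _ _⟩

/-! ### Counts with an arbitrary set of later closers, and their equidistribution -/

open Classical in
/-- The diagrams with openers `O`, whose closers are those in `C` (all before `t`) and `h` later
ones, number `N`; the last two closers end ascending and descending pairs of arcs equally often. -/
structure Census (O C : Finset ℕ) (t h N : ℕ) : Prop where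
  closers_lt : ∀ j ∈ C, j < t
  card : ∀ E : Finset ℕ, (∀ x ∈ E, t ≤ x) → E.card = h → (diagrams O (C ∪ E)).card = N
  asc : ∀ (E : Finset ℕ) (d e : ℕ), (∀ x ∈ E, t ≤ x ∧ x < d) → t ≤ d → d < e → E.card + 2 = h →
    2 * ((diagrams O (C ∪ insert d (insert e E))).filter (Asc d e)).card = N
  eq_zero : 5 ≤ h → N = 0

theorem card_insert_insert {E : Finset ℕ} {d e : ℕ} (hE : ∀ x ∈ E, x < d) (hde : d < e) :
    (insert d (insert e E)).card = E.card + 2 := by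
  rw [Finset.card_insert_of_notMem, Finset.card_insert_of_notMem]
  · exact fun h => (hE e h).not_gt hde
  · intro h
    rcases Finset.mem_insert.1 h with h | h
    · exact hde.ne h
    · exact (hE d h).false

open Classical in
theorem Census.not_asc {O C : Finset ℕ} {t h N : ℕ} (H : Census O C t h N) (E : Finset ℕ)
    (d e : ℕ) (hE : ∀ x ∈ E, t ≤ x ∧ x < d) (hd : t ≤ d) (hde : d < e) (hh : E.card + 2 = h) :
    2 * ((diagrams O (C ∪ insert d (insert e E))).filter (¬ Asc d e ·)).card = N := by
  have h1 := H.asc E d e hE hd hde hh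
  have h2 := H.card (insert d (insert e E)) ?_ ?_
  · have := Finset.card_filter_add_card_filter_not (s := diagrams O (C ∪ insert d (insert e E)))
      (Asc d e)
    omega
  · intro x hx
    rcases Finset.mem_insert.1 hx with rfl | hx
    · exact hd
    · rcases Finset.mem_insert.1 hx with rfl | hx
      · omega
      · exact (hE x hx).1
  · rw [card_insert_insert (fun x hx => (hE x hx).2) hde, hh]

theorem exists_insert_max {E : Finset ℕ} {k : ℕ} (h : E.card = k + 1) :
    ∃ e E', E = insert e E' ∧ (∀ x ∈ E', x < e) ∧ E'.card = k := by
  have hne : E.Nonempty := Finset.card_pos.1 (by omega)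
  refine ⟨E.max' hne, E.erase (E.max' hne), (Finset.insert_erase (E.max'_mem hne)).symm, ?_, ?_⟩
  · exact fun x hx => E.lt_max'_of_mem_erase_max' hne hx
  · rw [Finset.card_erase_of_mem (E.max'_mem hne), h, Nat.add_sub_cancel]

open Classical in
-- From two later closers on, the total count is the sum of the ascending and the descending half,
-- so the two halves suffice.
theorem Census.of_asc {O C : Finset ℕ} {t h N : ℕ} (hC : ∀ j ∈ C, j < t) (hh : 2 ≤ h)
    (h0 : 5 ≤ h → N = 0)
    (H : ∀ (E : Finset ℕ) (d e : ℕ), (∀ x ∈ E, t ≤ x ∧ x < d) → t ≤ d → d < e → E.card + 2 = h →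
      2 * ((diagrams O (C ∪ insert d (insert e E))).filter (Asc d e)).card = N ∧
      2 * ((diagrams O (C ∪ insert d (insert e E))).filter (¬ Asc d e ·)).card = N) :
    Census O C t h N := by
  refine ⟨hC, fun E hE hcard => ?_, fun E d e a b c f => (H E d e a b c f).1, h0⟩
  obtain ⟨k, rfl⟩ : ∃ k, h = k + 2 := ⟨h - 2, by omega⟩
  obtain ⟨e, E₁, rfl, h1, hcard⟩ := exists_insert_max hcard
  obtain ⟨d, E, rfl, h2, hcard⟩ := exists_insert_max hcard
  rw [Finset.insert_comm] at hE ⊢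
  obtain ⟨h3, h4⟩ := H E d e (fun x hx => ⟨hE x (by simp [hx]), h2 x hx⟩) (hE d (by simp))
    (h1 d (by simp)) (by omega)
  have := Finset.card_filter_add_card_filter_not (s := diagrams O (C ∪ insert d (insert e E)))
    (Asc d e)
  omega

theorem Census.skip {O C : Finset ℕ} {t h N : ℕ} (H : Census O C t h N) :
    Census O C (t + 1) h N where
  closers_lt j hj := (H.closers_lt j hj).trans (Nat.lt_succ_self t)
  card E hE := H.card E fun x hx => (Nat.le_succ t).trans (hE x hx)
  asc E d e hE hd := H.asc E d e (fun x hx => ⟨(Nat.le_succ t).trans (hE x hx).1, (hE x hx).2⟩)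
    ((Nat.le_succ t).trans hd)
  eq_zero := H.eq_zero

/-- The set of later closers was arbitrary, so it could have contained `t`. Closing at `t` merely
moves this point from `E` to `C`. -/
theorem Census.close {O C : Finset ℕ} {t h N : ℕ} (H : Census O C t (h + 1) N) :
    Census O (insert t C) (t + 1) h N where
  closers_lt j hj := by
    rcases Finset.mem_insert.1 hj with rfl | hj
    · exact Nat.lt_succ_self _
    · exact (H.closers_lt j hj).trans (Nat.lt_succ_self t)
  card E hE hcard := by
    rw [Finset.insert_union, ← Finset.union_insert]
    refine H.card _ ?_ ?_
    · intro x hx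
      rcases Finset.mem_insert.1 hx with rfl | hx
      · rfl
      · exact (Nat.le_succ t).trans (hE x hx)
    · rw [Finset.card_insert_of_notMem (fun h => by simpa using hE t h), hcard]
  asc E d e hE hd hde hcard := by
    rw [Finset.insert_union, ← Finset.union_insert, Finset.insert_comm t, Finset.insert_comm t]
    refine H.asc _ d e ?_ (by omega) hde ?_
    · intro x hx
      rcases Finset.mem_insert.1 hx with rfl | hx
      · exact ⟨le_rfl, hd⟩
      · exact ⟨by have := hE x hx; omega, (hE x hx).2⟩
    · rw [Finset.card_insert_of_notMem (fun h => by simpa using (hE t h).1)]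
      omega
  eq_zero h5 := H.eq_zero (by omega)

theorem census_empty : Census ∅ ∅ 0 0 1 where
  closers_lt := by simp
  card E _ hE := by
    rw [Finset.card_eq_zero.1 hE, Finset.card_eq_one]
    refine ⟨∅, Finset.eq_singleton_iff_unique_mem.2 ⟨?_, fun A hA => ?_⟩⟩
    · rw [mem_diagrams]
      exact ⟨⟨by simp, by simp, by simp, by simp, by simp⟩, ⟨by simp, by simp⟩⟩
    · refine Finset.eq_empty_of_forall_notMem fun p hp => ?_
      simpa using ((mem_diagrams.1 hA).1.mem p.1 p.2 hp).1
  asc := by simp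
  eq_zero := by simp

open Classical in
theorem card_filter_diagrams_insert_union {O C E : Finset ℕ} {t : ℕ} (hO : ∀ i ∈ O, i < t)
    (hC : ∀ j ∈ C, j ≤ t) (hE : ∀ x ∈ E, t < x) (Q : Finset (ℕ × ℕ) → Prop) [DecidablePred Q] :
    ((diagrams (insert t O) (C ∪ E)).filter Q).card = ∑ e ∈ E,
      ((diagrams O (C ∪ E.erase e)).filter
        fun A => Insertable t e A ∧ Q (insert (t, e) A)).card := by
  have h1 : (C ∪ E).filter (t < ·) = E := by
    ext x
    simp only [Finset.mem_filter, Finset.mem_union]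
    have h1 := hC x
    have h2 := hE x
    constructor
    · rintro ⟨h | h, h'⟩
      · exact absurd (h1 h) (by omega)
      · exact h
    · exact fun h => ⟨Or.inr h, h2 h⟩
  rw [card_filter_diagrams_insert hO, h1]
  refine Finset.sum_congr rfl fun e he => ?_
  rw [Finset.erase_union_distrib,
    Finset.erase_eq_of_notMem fun h => (hC e h).not_gt (hE e he)]

/-! ### The effect of a new opener -/

/-- The number of ways to choose the rank of a new arc above `h` open arcs, on average. -/
def growth : ℕ → ℕ
  | 0 => 1
  | 1 => 2
  | 2 => 2
  | 3 => 1
  | _ => 0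

theorem Census.push_zero {O C : Finset ℕ} {t N : ℕ} (hO : ∀ i ∈ O, i < t)
    (H : Census O C (t + 1) 0 N) : Census (insert t O) C (t + 1) 1 N := by
  classical
  have hC : ∀ j ∈ C, j ≤ t := fun j hj => Nat.lt_succ_iff.1 (H.closers_lt j hj)
  refine ⟨H.closers_lt, fun E hE hcard => ?_, fun E d e _ _ _ h => by omega, by simp⟩
  obtain ⟨e, rfl⟩ := Finset.card_eq_one.1 hcard
  have := card_filter_diagrams_insert_union hO hC hE fun _ => True
  rw [Finset.filter_true] at this
  rw [this, Finset.sum_singleton, Finset.erase_singleton, ← H.card ∅ (by simp) rfl]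
  congr 1
  refine Finset.filter_true_of_mem fun A hA => ⟨?_, trivial⟩
  rw [insertable_iff hA hC (by simp)]
  simp

/-- Both places are admissible. Since `t` is the largest opener, ending at `d` makes the last pair
descend and ending at `e` makes it ascend. -/
theorem Census.push_one {O C : Finset ℕ} {t N : ℕ} (hO : ∀ i ∈ O, i < t)
    (H : Census O C (t + 1) 1 N) : Census (insert t O) C (t + 1) 2 (2 * N) := by
  classical
  have hC : ∀ j ∈ C, j ≤ t := fun j hj => Nat.lt_succ_iff.1 (H.closers_lt j hj)
  refine Census.of_asc H.closers_lt le_rfl (by simp) fun E d e _ hd hde hcard => ?_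
  obtain rfl : E = ∅ := Finset.card_eq_zero.1 (by omega)
  have hd' : ∀ x ∈ ({d} : Finset ℕ), t < x := by simp; omega
  have he' : ∀ x ∈ ({e} : Finset ℕ), t < x := by simp; omega
  have hE : ∀ x ∈ ({d, e} : Finset ℕ), t < x := by simp; omega
  have hdC : d ∉ C := fun h => by have := hC d h; omega
  have e1 : ({d, e} : Finset ℕ).erase d = {e} := by
    ext x; simp; omega
  have e2 : ({d, e} : Finset ℕ).erase e = {d} := by
    ext x; simp; omega
  have a1 : ∀ A ∈ diagrams O (C ∪ {e}),
      Insertable t d A ∧ ¬ Asc d e (insert (t, d) A) := fun A hA => by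
    refine ⟨?_, not_asc_insert (C := C ∪ {d, e}) ?_ hO hde.ne⟩
    · rw [insertable_iff hA hC he']
      simp
    · rwa [Finset.erase_union_distrib, Finset.erase_eq_of_notMem hdC, e1]
  have a2 : ∀ A ∈ diagrams O (C ∪ {d}),
      Insertable t e A ∧ Asc d e (insert (t, e) A) := fun A hA => by
    refine ⟨?_, asc_insert hA hO (by simp)⟩
    rw [insertable_iff hA hC hd']
    simp
  simp only [insert_empty_eq]
  rw [card_filter_diagrams_insert_union hO hC hE, card_filter_diagrams_insert_union hO hC hE,
    Finset.sum_pair hde.ne, Finset.sum_pair hde.ne, e1, e2,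
    Finset.filter_false_of_mem (s := diagrams O (C ∪ {e})) fun A hA => fun h => (a1 A hA).2 h.2,
    Finset.filter_true_of_mem (s := diagrams O (C ∪ {d})) a2,
    Finset.filter_true_of_mem (s := diagrams O (C ∪ {e})) a1,
    Finset.filter_false_of_mem (s := diagrams O (C ∪ {d})) fun A hA => fun h => h.2 (a2 A hA).2,
    H.card {d} (by simp; omega) rfl, H.card {e} (by simp; omega) rfl]
  simp

/-- With closers `c < d < e`, the middle place is always admissible and makes the last pair descend.
The place `e` requires the arcs at `c, d` to descend, the place `c` requires those at `d, e` to
ascend, and both leave the last pair ascending. By equidistribution the contributions are `N`, `N /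
2` and `N / 2`. -/
theorem Census.push_two {O C : Finset ℕ} {t N : ℕ} (hO : ∀ i ∈ O, i < t)
    (H : Census O C (t + 1) 2 N) : Census (insert t O) C (t + 1) 3 (2 * N) := by
  classical
  have hC : ∀ j ∈ C, j ≤ t := fun j hj => Nat.lt_succ_iff.1 (H.closers_lt j hj)
  refine Census.of_asc H.closers_lt (by simp) (by simp) fun E d e hEd hd hde hcard => ?_
  obtain ⟨c, rfl⟩ : ∃ c, E = {c} := Finset.card_eq_one.1 (by omega)
  obtain ⟨hc, hcd⟩ := hEd c (by simp)
  have hE : ∀ x ∈ insert d (insert e ({c} : Finset ℕ)), t < x := by simp; omega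
  have hdC : d ∉ C := fun h => by have := hC d h; omega
  have e1 : (insert d (insert e ({c} : Finset ℕ))).erase d = {c, e} := by
    ext x; simp; omega
  have e2 : (insert d (insert e ({c} : Finset ℕ))).erase e = {c, d} := by
    ext x; simp; omega
  have e3 : (insert d (insert e ({c} : Finset ℕ))).erase c = {d, e} := by
    ext x; simp; omega
  have a1 : ∀ A ∈ diagrams O (C ∪ {c, e}),
      Insertable t d A ∧ ¬ Asc d e (insert (t, d) A) := fun A hA => by
    refine ⟨?_, not_asc_insert (C := C ∪ insert d (insert e ({c} : Finset ℕ))) ?_ hO hde.ne⟩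
    · rw [insertable_iff hA hC (by simp; omega)]
      simp
      omega
    · rwa [Finset.erase_union_distrib, Finset.erase_eq_of_notMem hdC, e1]
  have a2 : ∀ A ∈ diagrams O (C ∪ {c, d}), Asc d e (insert (t, e) A) ∧
      (Insertable t e A ↔ ¬ Asc c d A) := fun A hA => by
    refine ⟨asc_insert hA hO (by simp), ?_⟩
    have h := (mem_diagrams.1 hA).1
    have := h.opener_ne (d := c) (e := d) (by simp) (by simp) (by omega)
    rw [insertable_iff hA hC (by simp; omega), h.asc_iff (by simp) (by simp)]
    simp
    omega
  have a3 : ∀ A ∈ diagrams O (C ∪ {d, e}), (Asc d e (insert (t, c) A) ↔ Asc d e A) ∧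
      (Insertable t c A ↔ Asc d e A) := fun A hA => by
    refine ⟨asc_insert_of_ne (by omega) (by omega), ?_⟩
    have h := (mem_diagrams.1 hA).1
    rw [insertable_iff hA hC (by simp; omega), h.asc_iff (by simp) (by simp)]
    simp
    omega
  have s1 : ∀ f : ℕ → ℕ, ∑ x ∈ insert d (insert e ({c} : Finset ℕ)), f x = f d + (f e + f c) := by
    intro f
    rw [Finset.sum_insert (by simp; omega), Finset.sum_pair (by omega)]
  rw [card_filter_diagrams_insert_union hO hC hE, card_filter_diagrams_insert_union hO hC hE,
    s1, s1, e1, e2, e3,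
    Finset.filter_false_of_mem (s := diagrams O (C ∪ {c, e})) fun A hA => fun h => (a1 A hA).2 h.2,
    Finset.filter_true_of_mem (s := diagrams O (C ∪ {c, e})) a1,
    Finset.filter_congr (s := diagrams O (C ∪ {c, d})) (q := fun A => ¬ Asc c d A)
      (fun A hA => by have := a2 A hA; tauto),
    Finset.filter_false_of_mem (s := diagrams O (C ∪ {c, d}))
      (p := fun A => Insertable t e A ∧ ¬ Asc d e (insert (t, e) A))
      fun A hA => fun h => h.2 (a2 A hA).1,
    Finset.filter_congr (s := diagrams O (C ∪ {d, e})) (q := Asc d e)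
      (fun A hA => by have := a3 A hA; tauto),
    Finset.filter_false_of_mem (s := diagrams O (C ∪ {d, e}))
      (p := fun A => Insertable t c A ∧ ¬ Asc d e (insert (t, c) A))
      fun A hA => by have := a3 A hA; tauto,
    H.card {c, e} (by simp; omega) (Finset.card_pair (by omega))]
  have b1 := H.asc ∅ d e (by simp) hd hde rfl
  have b2 := H.not_asc ∅ c d (by simp) hc hcd rfl
  simp only [insert_empty_eq] at b1 b2
  simp only [Finset.card_empty]
  omega

/-- With closers `b < c < d < e`, the outer places `b` and `e` would require a monotone triple. The
place `c` requires an ascent at `d, e`. The place `d` requires a descent at `b, c`, which amounts to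
an ascent at `c, e` because `b, c, e` is not monotone. Each holds for half of the diagrams; the
first gives an ascending last pair, the second a descending one. -/
theorem Census.push_three {O C : Finset ℕ} {t N : ℕ} (hO : ∀ i ∈ O, i < t)
    (H : Census O C (t + 1) 3 N) : Census (insert t O) C (t + 1) 4 N := by
  classical
  have hC : ∀ j ∈ C, j ≤ t := fun j hj => Nat.lt_succ_iff.1 (H.closers_lt j hj)
  refine Census.of_asc H.closers_lt (by simp) (by simp) fun E d e hEd hd hde hcard => ?_
  obtain ⟨c, E, rfl, hbc, hE⟩ := exists_insert_max (k := 1) (E := E) (by omega)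
  obtain ⟨b, rfl⟩ := Finset.card_eq_one.1 hE
  obtain ⟨hc, hcd⟩ := hEd c (by simp)
  have hb := (hEd b (by simp)).1
  replace hbc := hbc b (by simp)
  have hE : ∀ x ∈ insert d (insert e ({c, b} : Finset ℕ)), t < x := by simp; omega
  have hdC : d ∉ C := fun h => by have := hC d h; omega
  have e1 : (insert d (insert e ({c, b} : Finset ℕ))).erase d = insert c (insert e {b}) := by
    ext x; simp; omega
  have e2 : (insert d (insert e ({c, b} : Finset ℕ))).erase e = insert c (insert d {b}) := by
    ext x; simp; omega
  have e3 : (insert d (insert e ({c, b} : Finset ℕ))).erase c = insert d (insert e {b}) := by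
    ext x; simp; omega
  have e4 : (insert d (insert e ({c, b} : Finset ℕ))).erase b = insert d (insert e {c}) := by
    ext x; simp; omega
  have a1 : ∀ A ∈ diagrams O (C ∪ insert c (insert e {b})),
      ¬ Asc d e (insert (t, d) A) ∧ (Insertable t d A ↔ Asc c e A) := fun A hA => by
    refine ⟨not_asc_insert (C := C ∪ insert d (insert e ({c, b} : Finset ℕ))) ?_ hO hde.ne, ?_⟩
    · rwa [Finset.erase_union_distrib, Finset.erase_eq_of_notMem hdC, e1]
    · have h := (mem_diagrams.1 hA).1
      have n1 := h.opener_ne (d := b) (e := c) (by simp) (by simp) (by omega)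
      have n2 := h.opener_ne (d := c) (e := e) (by simp) (by simp) (by omega)
      have n3 := not_monotone hA hO (a := b) (b := c) (c := e) (by simp; omega) (by simp)
        (by simp) (by simp) hbc (by omega)
      rw [insertable_iff hA hC (by simp; omega), h.asc_iff (by simp) (by simp)]
      simp
      omega
  have a2 : ∀ A ∈ diagrams O (C ∪ insert c (insert d {b})), ¬ Insertable t e A := fun A hA => by
    have h := (mem_diagrams.1 hA).1
    have n3 := not_monotone hA hO (a := b) (b := c) (c := d) (by simp; omega) (by simp)
      (by simp) (by simp) hbc (by omega)
    rw [insertable_iff hA hC (by simp; omega)]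
    simp
    omega
  have a3 : ∀ A ∈ diagrams O (C ∪ insert d (insert e {b})),
      (Asc d e (insert (t, c) A) ↔ Asc d e A) ∧ (Insertable t c A ↔ Asc d e A) := fun A hA => by
    refine ⟨asc_insert_of_ne (by omega) (by omega), ?_⟩
    have h := (mem_diagrams.1 hA).1
    rw [insertable_iff hA hC (by simp; omega), h.asc_iff (by simp) (by simp)]
    simp
    omega
  have a4 : ∀ A ∈ diagrams O (C ∪ insert d (insert e {c})), ¬ Insertable t b A := fun A hA => by
    have h := (mem_diagrams.1 hA).1
    have n3 := not_monotone hA hO (a := c) (b := d) (c := e) (by simp; omega) (by simp)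
      (by simp) (by simp) hcd (by omega)
    rw [insertable_iff hA hC (by simp; omega)]
    simp
    omega
  have s1 : ∀ f : ℕ → ℕ, ∑ x ∈ insert d (insert e ({c, b} : Finset ℕ)), f x =
      f d + (f e + (f c + f b)) := by
    intro f
    rw [Finset.sum_insert (by simp; omega), Finset.sum_insert (by simp; omega),
      Finset.sum_pair (by omega)]
  rw [card_filter_diagrams_insert_union hO hC hE, card_filter_diagrams_insert_union hO hC hE,
    s1, s1, e1, e2, e3, e4,
    Finset.filter_false_of_mem (s := diagrams O (C ∪ insert c (insert e {b})))
      fun A hA => fun h => (a1 A hA).1 h.2,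
    Finset.filter_congr (s := diagrams O (C ∪ insert c (insert e {b}))) (q := Asc c e)
      (fun A hA => by have := a1 A hA; tauto),
    Finset.filter_false_of_mem (s := diagrams O (C ∪ insert c (insert d {b})))
      fun A hA => fun h => a2 A hA h.1,
    Finset.filter_false_of_mem (s := diagrams O (C ∪ insert c (insert d {b})))
      fun A hA => fun h => a2 A hA h.1,
    Finset.filter_congr (s := diagrams O (C ∪ insert d (insert e {b}))) (q := Asc d e)
      (fun A hA => by have := a3 A hA; tauto),
    Finset.filter_false_of_mem (s := diagrams O (C ∪ insert d (insert e {b})))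
      (p := fun A => Insertable t c A ∧ ¬ Asc d e (insert (t, c) A))
      fun A hA => by have := a3 A hA; tauto,
    Finset.filter_false_of_mem (s := diagrams O (C ∪ insert d (insert e {c})))
      fun A hA => fun h => a4 A hA h.1,
    Finset.filter_false_of_mem (s := diagrams O (C ∪ insert d (insert e {c})))
      fun A hA => fun h => a4 A hA h.1]
  have b1 := H.asc {b} d e (by simp; omega) hd hde rfl
  have b2 := H.asc {b} c e (by simp; omega) hc (by omega) rfl
  simp only [Finset.card_empty]
  omega

/-- With three of the four closers on one side of `e`, their arcs would be monotone. With two on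
each side, the first two descend and the last two ascend, and either order of the middle two
completes a monotone triple. -/
theorem not_insertable_of_card_four {O C E : Finset ℕ} {A : Finset (ℕ × ℕ)} {t e : ℕ}
    (hA : A ∈ diagrams O (C ∪ E)) (hO : ∀ i ∈ O, i < t) (hC : ∀ j ∈ C, j ≤ t)
    (hE : ∀ x ∈ E, t < x) (he : e ∉ E) (hcard : E.card = 4) : ¬ Insertable t e A := by
  obtain ⟨d, E, rfl, hd, hcard⟩ := exists_insert_max hcard
  obtain ⟨c, E, rfl, hc, hcard⟩ := exists_insert_max hcard
  obtain ⟨b, E, rfl, hb, hcard⟩ := exists_insert_max hcard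
  obtain ⟨a, rfl⟩ := Finset.card_eq_one.1 hcard
  replace hd := hd c (by simp)
  replace hc := hc b (by simp)
  replace hb := hb a (by simp)
  have h := (mem_diagrams.1 hA).1
  have n1 := not_monotone hA hO hE (a := a) (b := b) (c := c) (by simp) (by simp) (by simp) hb hc
  have n2 := not_monotone hA hO hE (a := b) (b := c) (c := d) (by simp) (by simp) (by simp) hc hd
  have n3 := h.opener_ne (d := b) (e := c) (by simp) (by simp) (by omega)
  rw [insertable_iff hA hC hE]
  intro k
  have k1 := k a (by simp) b (by simp) hb
  have k2 := k b (by simp) c (by simp) hc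
  have k3 := k c (by simp) d (by simp) hd
  simp only [Finset.mem_insert, Finset.mem_singleton, not_or] at he
  omega

theorem Census.push_of_four_le {O C : Finset ℕ} {t h N : ℕ} (hO : ∀ i ∈ O, i < t) (h4 : 4 ≤ h)
    (H : Census O C (t + 1) h N) : Census (insert t O) C (t + 1) (h + 1) 0 := by
  classical
  have hC : ∀ j ∈ C, j ≤ t := fun j hj => Nat.lt_succ_iff.1 (H.closers_lt j hj)
  have key : ∀ E : Finset ℕ, (∀ x ∈ E, t < x) → E.card = h + 1 →
      ∀ (Q : Finset (ℕ × ℕ) → Prop) [DecidablePred Q], ((diagrams (insert t O) (C ∪ E)).filter Q).card = 0 := by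
    intro E hE hcard Q _
    rw [card_filter_diagrams_insert_union hO hC hE]
    refine Finset.sum_eq_zero fun e he => ?_
    have hcard' : (E.erase e).card = h := by rw [Finset.card_erase_of_mem he, hcard]; simp
    have hE' : ∀ x ∈ E.erase e, t < x := fun x hx => hE x (Finset.mem_of_mem_erase hx)
    -- Above four open arcs there is no diagram left to extend.
    rcases eq_or_lt_of_le h4 with rfl | h5
    · rw [Finset.filter_false_of_mem, Finset.card_empty]
      intro A hA hi
      exact not_insertable_of_card_four hA hO hC hE' (Finset.notMem_erase _ _) hcard' hi.1
    · have := H.card (E.erase e) (fun x hx => hE' x hx) hcard'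
      rw [H.eq_zero h5] at this
      rw [Finset.card_eq_zero.1 this]
      simp
  refine Census.of_asc H.closers_lt (by omega) (by simp) fun E d e hEd hd hde hcard => ?_
  have hE : ∀ x ∈ insert d (insert e E), t < x := by
    intro x hx
    simp only [Finset.mem_insert] at hx
    rcases hx with rfl | rfl | hx
    · omega
    · omega
    · exact (hEd x hx).1
  have hc : (insert d (insert e E)).card = h + 1 := by
    rw [card_insert_insert (fun x hx => (hEd x hx).2) hde, hcard]
  exact ⟨by rw [key _ hE hc], by rw [key _ hE hc]⟩

theorem Census.push {O C : Finset ℕ} {t h N : ℕ} (hO : ∀ i ∈ O, i < t)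
    (H : Census O C (t + 1) h N) : Census (insert t O) C (t + 1) (h + 1) (growth h * N) := by
  match h, H with
  | 0, H => simpa [growth] using H.push_zero hO
  | 1, H => exact H.push_one hO
  | 2, H => exact H.push_two hO
  | 3, H => simpa [growth] using H.push_three hO
  | k + 4, H => simpa [growth] using H.push_of_four_le hO (by omega)

/-! ### The number of diagrams with given openers and closers -/

/-- The number of arcs that are open after the first `t` points, where a point that is both an
opener and a closer ends an arc before it begins one. -/
def openArcs (O C : Finset ℕ) : ℕ → ℕ
  | 0 => 0
  | t + 1 => (openArcs O C t - if t ∈ C then 1 else 0) + if t ∈ O then 1 else 0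

/-- The number of ways to arrange the arcs after reading the first `t` points. -/
def weight (O C : Finset ℕ) : ℕ → ℕ
  | 0 => 1
  | t + 1 => (if t ∈ C ∧ openArcs O C t = 0 then 0 else weight O C t) *
      if t ∈ O then growth (openArcs O C t - if t ∈ C then 1 else 0) else 1

theorem filter_lt_succ (S : Finset ℕ) (t : ℕ) : S.filter (· < t + 1) =
    if t ∈ S then insert t (S.filter (· < t)) else S.filter (· < t) := by
  ext x
  split_ifs with h
  · simp only [Finset.mem_filter, Finset.mem_insert]
    refine ⟨fun k => ?_, ?_⟩
    · rcases eq_or_lt_of_le (Nat.lt_succ_iff.1 k.2) with h | h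
      · exact Or.inl h
      · exact Or.inr ⟨k.1, h⟩
    · rintro (rfl | k)
      · exact ⟨h, Nat.lt_succ_self _⟩
      · exact ⟨k.1, k.2.trans (Nat.lt_succ_self _)⟩
  · simp only [Finset.mem_filter]
    refine ⟨fun k => ⟨k.1, ?_⟩, fun k => ⟨k.1, k.2.trans (Nat.lt_succ_self _)⟩⟩
    rcases eq_or_lt_of_le (Nat.lt_succ_iff.1 k.2) with h' | h'
    · exact absurd (h' ▸ k.1) h
    · exact h'

theorem card_filter_lt_succ (S : Finset ℕ) (t : ℕ) : (S.filter (· < t + 1)).card =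
    (S.filter (· < t)).card + if t ∈ S then 1 else 0 := by
  rw [filter_lt_succ]
  split_ifs
  · rw [Finset.card_insert_of_notMem (by simp)]
  · rfl

/-- The hypothesis keeps the truncated subtraction in `openArcs` exact. At a point that is both
closer and opener, `close` is applied before `push`, since an arc ending there and one beginning
there are never open together. -/
theorem census_filter (O C : Finset ℕ) (m : ℕ)
    (h : ∀ t < m, t ∈ C → openArcs O C t ≠ 0) :
    Census (O.filter (· < m)) (C.filter (· < m)) m (openArcs O C m) (weight O C m) ∧
      (O.filter (· < m)).card = (C.filter (· < m)).card + openArcs O C m := by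
  induction m with
  | zero => simpa [openArcs, weight] using census_empty
  | succ m ih =>
    obtain ⟨H, hcard⟩ := ih fun t ht => h t (by omega)
    rw [card_filter_lt_succ, card_filter_lt_succ, filter_lt_succ, filter_lt_succ]
    simp only [openArcs, weight]
    have hO : ∀ i ∈ O.filter (· < m), i < m := fun i hi => (Finset.mem_filter.1 hi).2
    by_cases hC : m ∈ C
    · have h0 := h m (Nat.lt_succ_self m) hC
      obtain ⟨k, hk⟩ := Nat.exists_eq_succ_of_ne_zero h0
      rw [hk] at H hcard ⊢
      by_cases hm : m ∈ O
      · simp only [hC, hm, if_true]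
        refine ⟨?_, by simp; omega⟩
        simpa [mul_comm] using H.close.push hO
      · simp only [hC, hm, if_true, if_false]
        refine ⟨by simpa using H.close, by simp; omega⟩
    · by_cases hm : m ∈ O
      · simp only [hC, hm, if_true, if_false]
        refine ⟨?_, by simp; omega⟩
        simpa [mul_comm] using H.skip.push hO
      · simp only [hC, hm, if_false]
        refine ⟨by simpa using H.skip, by simp; omega⟩

theorem weight_eq_zero (O C : Finset ℕ) {t m : ℕ} (htm : t < m) (ht : t ∈ C)
    (h : openArcs O C t = 0) : weight O C m = 0 := by
  induction m, htm using Nat.le_induction with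
  | base => simp [weight, ht, h]
  | succ n _ ih => simp [weight, ih]

/-- The number of sparse diagrams with given openers and closers. -/
theorem card_diagrams {O C : Finset ℕ} {m : ℕ} (hO : ∀ i ∈ O, i < m) (hC : ∀ j ∈ C, j < m) :
    (diagrams O C).card = if openArcs O C m = 0 then weight O C m else 0 := by
  have hO' : O.filter (· < m) = O := Finset.filter_true_of_mem hO
  have hC' : C.filter (· < m) = C := Finset.filter_true_of_mem hC
  by_cases h : ∀ t < m, t ∈ C → openArcs O C t ≠ 0
  · obtain ⟨H, hcard⟩ := census_filter O C m h
    rw [hO', hC'] at H hcard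
    split_ifs with h0
    · simpa using H.card ∅ (by simp) (by rw [h0]; rfl)
    -- There are more openers than closers.
    · rw [Finset.card_eq_zero, Finset.eq_empty_iff_forall_notMem]
      intro A hA
      have := (mem_diagrams.1 hA).1.card_openers_le
      omega
  · have hex : ∃ t, t < m ∧ t ∈ C ∧ openArcs O C t = 0 := by
      push Not at h
      exact h
    classical
    -- At the first closer met with no open arc, openers and closers before it are equally many, so
    -- this closer has no partner. Minimality makes the census valid up to that point.
    obtain ⟨htm, htC, ht⟩ := Nat.find_spec hex
    set t := Nat.find hex with ht_def
    rw [weight_eq_zero O C htm htC ht, ite_self, Finset.card_eq_zero,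
      Finset.eq_empty_iff_forall_notMem]
    intro A hA
    have h1 := (mem_diagrams.1 hA).1.card_closers_le t
    have h2 := (census_filter O C t fun s hs hsC hs0 =>
      Nat.find_min hex hs ⟨hs.trans htm, hsC, hs0⟩).2
    rw [card_filter_lt_succ, if_pos htC] at h1
    omega

theorem openArcs_congr {O C O' C' : Finset ℕ} {t : ℕ} (hO : ∀ s < t, s ∈ O ↔ s ∈ O')
    (hC : ∀ s < t, s ∈ C ↔ s ∈ C') : openArcs O C t = openArcs O' C' t := by
  induction t with
  | zero => rfl
  | succ t ih =>
    rw [openArcs, openArcs, ih (fun s hs => hO s (by omega)) fun s hs => hC s (by omega)]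
    simp only [hO t (by omega), hC t (by omega)]

theorem weight_congr {O C O' C' : Finset ℕ} {t : ℕ} (hO : ∀ s < t, s ∈ O ↔ s ∈ O')
    (hC : ∀ s < t, s ∈ C ↔ s ∈ C') : weight O C t = weight O' C' t := by
  induction t with
  | zero => rfl
  | succ t ih =>
    have hO' : ∀ s < t, s ∈ O ↔ s ∈ O' := fun s hs => hO s (by omega)
    have hC' : ∀ s < t, s ∈ C ↔ s ∈ C' := fun s hs => hC s (by omega)
    rw [weight, weight, ih hO' hC', openArcs_congr hO' hC']
    simp only [hO t (by omega), hC t (by omega)]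

/-! ### Transfer recurrences on the number of open arcs -/

/-- The contribution of `(O, C)` to the arrangements with `h` open arcs after `t` points. -/
def weightAt (O C : Finset ℕ) (t h : ℕ) : ℕ := if openArcs O C t = h then weight O C t else 0

section Step

variable {O C O' C' : Finset ℕ} {t : ℕ}

theorem weightAt_succ (hO : ∀ s < t, s ∈ O' ↔ s ∈ O) (hC : ∀ s < t, s ∈ C' ↔ s ∈ C)
    (hOt : t ∉ O') (hCt : t ∉ C') (h : ℕ) : weightAt O' C' (t + 1) h = weightAt O C t h := by
  simp [weightAt, openArcs, weight, hOt, hCt, openArcs_congr hO hC, weight_congr hO hC]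

theorem weightAt_succ_close (hO : ∀ s < t, s ∈ O' ↔ s ∈ O) (hC : ∀ s < t, s ∈ C' ↔ s ∈ C)
    (hOt : t ∉ O') (hCt : t ∈ C') (h : ℕ) :
    weightAt O' C' (t + 1) h = weightAt O C t (h + 1) := by
  simp only [weightAt, openArcs, weight, hOt, hCt, openArcs_congr hO hC, weight_congr hO hC]
  simp only [true_and, if_true, if_false, mul_one, add_zero]
  -- Truncation also sends height 0 to height 0, but that branch carries weight 0.
  split_ifs <;> omega

theorem weightAt_succ_open (hO : ∀ s < t, s ∈ O' ↔ s ∈ O) (hC : ∀ s < t, s ∈ C' ↔ s ∈ C)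
    (hOt : t ∈ O') (hCt : t ∉ C') (h : ℕ) :
    weightAt O' C' (t + 1) (h + 1) = growth h * weightAt O C t h := by
  simp only [weightAt, openArcs, weight, hOt, hCt, openArcs_congr hO hC, weight_congr hO hC]
  simp only [false_and, if_true, if_false, Nat.sub_zero, add_left_inj]
  split_ifs with h1
  · rw [h1, mul_comm]
  · simp

theorem weightAt_succ_close_open (hO : ∀ s < t, s ∈ O' ↔ s ∈ O)
    (hC : ∀ s < t, s ∈ C' ↔ s ∈ C) (hOt : t ∈ O') (hCt : t ∈ C') (h : ℕ) :
    weightAt O' C' (t + 1) (h + 1) = growth h * weightAt O C t (h + 1) := by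
  simp only [weightAt, openArcs, weight, hOt, hCt, openArcs_congr hO hC, weight_congr hO hC]
  simp only [true_and, if_true, add_left_inj]
  by_cases h0 : openArcs O C t = 0
  · simp [h0]
  · rw [if_neg h0]
    by_cases h1 : openArcs O C t = h + 1
    · simp [h1, mul_comm]
    · rw [if_neg h1, if_neg (by omega), mul_zero]

theorem weightAt_succ_zero (hOt : t ∈ O') : weightAt O' C' (t + 1) 0 = 0 := by
  simp [weightAt, openArcs, hOt]

end Step

/-- The number of arrangements of arcs on `t` points with `h` open arcs, where every point may be
both an opener and a closer. -/
def partitionCount (t h : ℕ) : ℕ :=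
  ∑ O ∈ (Finset.range t).powerset, ∑ C ∈ (Finset.range t).powerset, weightAt O C t h

/-- The number of arrangements of arcs on `t` points with `h` open arcs, where every point is
either an opener or a closer. -/
def matchingCount (t h : ℕ) : ℕ :=
  ∑ O ∈ (Finset.range t).powerset, weightAt O (Finset.range t \ O) t h

theorem mem_insert_iff_of_lt {O : Finset ℕ} {t s : ℕ} (h : s < t) : s ∈ insert t O ↔ s ∈ O := by
  simp [h.ne]

theorem notMem_of_mem_powerset_range {O : Finset ℕ} {t : ℕ}
    (h : O ∈ (Finset.range t).powerset) : t ∉ O := fun ht => by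
  simpa using Finset.mem_powerset.1 h ht

/-- The four cases are whether `t` belongs to `O` and to `C`. The two without a new opener are
already evaluated here. -/
theorem partitionCount_succ (t h : ℕ) : partitionCount (t + 1) h =
    (partitionCount t h + partitionCount t (h + 1)) +
    ∑ O ∈ (Finset.range t).powerset, ∑ C ∈ (Finset.range t).powerset,
      (weightAt (insert t O) C (t + 1) h + weightAt (insert t O) (insert t C) (t + 1) h) := by
  simp only [partitionCount, Finset.range_add_one]
  rw [Finset.sum_powerset_insert Finset.notMem_range_self]
  simp only [Finset.sum_powerset_insert Finset.notMem_range_self (f := fun C => weightAt _ C _ _),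
    Finset.sum_add_distrib]
  congr 2
  · refine Finset.sum_congr rfl fun O hO => Finset.sum_congr rfl fun C hC => ?_
    exact weightAt_succ (fun _ _ => Iff.rfl) (fun _ _ => Iff.rfl)
      (notMem_of_mem_powerset_range hO) (notMem_of_mem_powerset_range hC) h
  · refine Finset.sum_congr rfl fun O hO => Finset.sum_congr rfl fun C hC => ?_
    exact weightAt_succ_close (fun _ _ => Iff.rfl) (fun _ h => mem_insert_iff_of_lt h)
      (notMem_of_mem_powerset_range hO) (Finset.mem_insert_self _ _) h

theorem partitionCount_succ_zero (t : ℕ) :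
    partitionCount (t + 1) 0 = partitionCount t 0 + partitionCount t 1 := by
  rw [partitionCount_succ, Nat.add_eq_left]
  refine Finset.sum_eq_zero fun O _ => Finset.sum_eq_zero fun C _ => ?_
  rw [weightAt_succ_zero (Finset.mem_insert_self _ _),
    weightAt_succ_zero (Finset.mem_insert_self _ _), add_zero]

theorem partitionCount_succ_succ (t h : ℕ) : partitionCount (t + 1) (h + 1) =
    (partitionCount t (h + 1) + partitionCount t (h + 2)) +
      growth h * (partitionCount t h + partitionCount t (h + 1)) := by
  rw [partitionCount_succ]
  congr 1
  simp only [partitionCount, ← Finset.sum_add_distrib, Finset.mul_sum]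
  refine Finset.sum_congr rfl fun O _ => Finset.sum_congr rfl fun C hC => ?_
  rw [weightAt_succ_open (fun _ h => mem_insert_iff_of_lt h) (fun _ _ => Iff.rfl)
      (Finset.mem_insert_self _ _) (notMem_of_mem_powerset_range hC),
    weightAt_succ_close_open (fun _ h => mem_insert_iff_of_lt h)
      (fun _ h => mem_insert_iff_of_lt h) (Finset.mem_insert_self _ _)
      (Finset.mem_insert_self _ _), mul_add]

theorem partitionCount_zero (h : ℕ) : partitionCount 0 h = if h = 0 then 1 else 0 := by
  simp [partitionCount, weightAt, openArcs, weight, eq_comm]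

theorem partitionCount_eq_zero {t h : ℕ} (hh : 5 ≤ h) : partitionCount t h = 0 := by
  induction t generalizing h with
  | zero => rw [partitionCount_zero, if_neg (by omega)]
  | succ t ih =>
    obtain ⟨k, rfl⟩ : ∃ k, h = k + 5 := ⟨h - 5, by omega⟩
    rw [partitionCount_succ_succ, ih hh, ih (by omega)]
    simp [growth]

theorem matchingCount_succ (t h : ℕ) : matchingCount (t + 1) h = matchingCount t (h + 1) +
    ∑ O ∈ (Finset.range t).powerset,
      weightAt (insert t O) (Finset.range (t + 1) \ insert t O) (t + 1) h := by
  rw [matchingCount, Finset.range_add_one, Finset.sum_powerset_insert Finset.notMem_range_self,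
    matchingCount]
  congr 1
  refine Finset.sum_congr rfl fun O hO => ?_
  have := notMem_of_mem_powerset_range hO
  refine weightAt_succ_close (fun _ _ => Iff.rfl) (fun s hs => ?_) this (by simp [this]) h
  simp [hs.ne]

theorem matchingCount_succ_zero (t : ℕ) : matchingCount (t + 1) 0 = matchingCount t 1 := by
  rw [matchingCount_succ, Nat.add_eq_left]
  exact Finset.sum_eq_zero fun O _ => weightAt_succ_zero (Finset.mem_insert_self _ _)

theorem matchingCount_succ_succ (t h : ℕ) : matchingCount (t + 1) (h + 1) =
    matchingCount t (h + 2) + growth h * matchingCount t h := by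
  rw [matchingCount_succ]
  congr 1
  rw [matchingCount, Finset.mul_sum]
  refine Finset.sum_congr rfl fun O hO => ?_
  refine weightAt_succ_open (fun _ h => mem_insert_iff_of_lt h) (fun s hs => ?_)
    (Finset.mem_insert_self _ _) (by simp) h
  simp [hs, hs.ne, hs.trans (Nat.lt_succ_self t)]

theorem matchingCount_zero (h : ℕ) : matchingCount 0 h = if h = 0 then 1 else 0 := by
  simp [matchingCount, weightAt, openArcs, weight, eq_comm]

theorem matchingCount_eq_zero {t h : ℕ} (hh : 5 ≤ h) : matchingCount t h = 0 := by
  induction t generalizing h with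
  | zero => rw [matchingCount_zero, if_neg (by omega)]
  | succ t ih =>
    obtain ⟨k, rfl⟩ : ∃ k, h = k + 5 := ⟨h - 5, by omega⟩
    rw [matchingCount_succ_succ, ih (by omega)]
    simp [growth]

/-- Two steps preserve the parity of the height, and heights from 5 on contribute nothing. The
resulting 3 by 3 matrix has eigenvalues 0, 1 and 5. -/
theorem matchingCount_two_mul_succ (n : ℕ) :
    matchingCount (2 * (n + 1)) 0 = matchingCount (2 * n) 0 + matchingCount (2 * n) 2 ∧
    matchingCount (2 * (n + 1)) 2 =
      2 * matchingCount (2 * n) 0 + 4 * matchingCount (2 * n) 2 + matchingCount (2 * n) 4 ∧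
    matchingCount (2 * (n + 1)) 4 = 2 * matchingCount (2 * n) 2 + matchingCount (2 * n) 4 := by
  rw [show 2 * (n + 1) = 2 * n + 1 + 1 by ring]
  have h6 := matchingCount_eq_zero (t := 2 * n) (h := 6) (by norm_num)
  simp only [matchingCount_succ_zero, matchingCount_succ_succ, growth, h6, Nat.reduceAdd]
  omega

theorem matchingCount_two_mul (n : ℕ) : 2 * matchingCount (2 * (n + 1)) 0 = 5 ^ n + 1 ∧
    matchingCount (2 * (n + 1)) 2 = 2 * 5 ^ n ∧ matchingCount (2 * (n + 1)) 4 + 1 = 5 ^ n := by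
  induction n with
  | zero =>
    have := matchingCount_two_mul_succ 0
    simp only [mul_zero, matchingCount_zero] at this
    simpa using this
  | succ n ih =>
    have := matchingCount_two_mul_succ (n + 1)
    rw [pow_succ]
    omega

/-! ### Generating functions -/

theorem mk_eq_add_X_mul {f : ℕ → ℚ} {a : ℚ} {B : PowerSeries ℚ} (h0 : f 0 = a)
    (h : ∀ n, f (n + 1) = PowerSeries.coeff n B) :
    PowerSeries.mk f = PowerSeries.C a + PowerSeries.X * B := by
  ext n
  cases n with
  | zero => simp [h0]
  | succ n => simp [PowerSeries.coeff_succ_X_mul, h]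

theorem two_smul_powerSeries (B : PowerSeries ℚ) : (2 : ℚ) • B = 2 * B := by
  rw [two_smul, two_mul]

theorem mk_matchingCount : (PowerSeries.mk fun n : ℕ => (matchingCount (2 * n) 0 : ℚ)) =
    (1 - 5 * PowerSeries.X + 2 * PowerSeries.X ^ 2) *
      (1 - 6 * PowerSeries.X + 5 * PowerSeries.X ^ 2)⁻¹ := by
  rw [PowerSeries.eq_mul_inv_iff_mul_eq (by simp)]
  set X : PowerSeries ℚ := PowerSeries.X
  set A : ℕ → PowerSeries ℚ :=
    fun h => PowerSeries.mk fun n : ℕ => (matchingCount (2 * n) h : ℚ) with hA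
  have e0 : A 0 = PowerSeries.C 1 + X * (A 0 + A 2) :=
    mk_eq_add_X_mul (by simp [matchingCount_zero]) fun n => by
      simp [hA, (matchingCount_two_mul_succ n).1]
  have e2 : A 2 = PowerSeries.C 0 + X * ((2 : ℚ) • A 0 + (2 : ℚ) • (2 : ℚ) • A 2 + A 4) :=
    mk_eq_add_X_mul (by simp [matchingCount_zero]) fun n => by
      simp only [hA, (matchingCount_two_mul_succ n).2.1, map_add, map_smul,
        PowerSeries.coeff_mk, smul_eq_mul]
      push_cast
      ring
  have e4 : A 4 = PowerSeries.C 0 + X * ((2 : ℚ) • A 2 + A 4) :=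
    mk_eq_add_X_mul (by simp [matchingCount_zero]) fun n => by
      simp [hA, (matchingCount_two_mul_succ n).2.2]
  simp only [two_smul_powerSeries, map_one, map_zero] at e0 e2 e4
  change A 0 * _ = _
  -- Cramer's rule: with `T` the transfer matrix on the heights 0, 2, 4, the multipliers form the
  -- first row of the adjugate of `1 - X T`, which eliminates `A 2` and `A 4`.
  linear_combination (1 - 5 * X + 2 * X ^ 2) * e0 + X * (1 - X) * e2 + X ^ 2 * e4

theorem mk_partitionCount : (PowerSeries.mk fun n : ℕ => (partitionCount n 0 : ℚ)) =
    (1 - 10 * PowerSeries.X + 32 * PowerSeries.X ^ 2 - 37 * PowerSeries.X ^ 3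
        + 12 * PowerSeries.X ^ 4) *
      ((1 - PowerSeries.X) *
        (1 - 10 * PowerSeries.X + 31 * PowerSeries.X ^ 2 - 30 * PowerSeries.X ^ 3
          + PowerSeries.X ^ 4))⁻¹ := by
  rw [PowerSeries.eq_mul_inv_iff_mul_eq (by simp)]
  set X : PowerSeries ℚ := PowerSeries.X
  set A : ℕ → PowerSeries ℚ :=
    fun h => PowerSeries.mk fun n : ℕ => (partitionCount n h : ℚ) with hA
  have e0 : A 0 = PowerSeries.C 1 + X * (A 0 + A 1) :=
    mk_eq_add_X_mul (by simp [partitionCount_zero]) fun n => by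
      simp [hA, partitionCount_succ_zero]
  have e : ∀ h, A (h + 1) = PowerSeries.C 0 +
      X * (A (h + 1) + A (h + 2) + (growth h : ℚ) • (A h + A (h + 1))) := fun h =>
    mk_eq_add_X_mul (by simp [partitionCount_zero]) fun n => by
      simp only [hA, partitionCount_succ_succ, map_add, map_smul, PowerSeries.coeff_mk,
        smul_eq_mul, Nat.cast_add, Nat.cast_mul]
  have h5 : A 5 = 0 := by
    ext n
    simp [hA, partitionCount_eq_zero]
  have e1 := e 0
  have e2 := e 1
  have e3 := e 2
  have e4 := e 3
  simp only [growth, Nat.cast_one, one_smul, Nat.cast_ofNat, two_smul_powerSeries, Nat.reduceAdd,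
    h5, map_one, map_zero] at e0 e1 e2 e3 e4
  change A 0 * _ = _
  -- Again the first row of an adjugate. The matrix is tridiagonal, so the multiplier of equation
  -- `k` is `X ^ k` times the trailing principal minor on the heights above `k`.
  linear_combination
    ((1 - 2 * X) * ((1 - 3 * X) * ((1 - 3 * X) * (1 - 2 * X) - X ^ 2) - 2 * X ^ 2 * (1 - 2 * X))
      - 2 * X ^ 2 * ((1 - 3 * X) * (1 - 2 * X) - X ^ 2)) * e0 +
    X * ((1 - 3 * X) * ((1 - 3 * X) * (1 - 2 * X) - X ^ 2) - 2 * X ^ 2 * (1 - 2 * X)) * e1 +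
    X ^ 2 * ((1 - 3 * X) * (1 - 2 * X) - X ^ 2) * e2 + X ^ 3 * (1 - 2 * X) * e3 + X ^ 4 * e4

/-! ### Lattice paths given by their east steps, and the boards below them -/

/-- The number of elements of `S` below `t`. -/
def countLt (S : Finset ℕ) (t : ℕ) : ℕ := (S.filter (· < t)).card

theorem countLt_succ (S : Finset ℕ) (t : ℕ) :
    countLt S (t + 1) = countLt S t + if t ∈ S then 1 else 0 :=
  card_filter_lt_succ S t

theorem countLt_mono (S : Finset ℕ) {s t : ℕ} (h : s ≤ t) : countLt S s ≤ countLt S t :=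
  Finset.card_le_card (Finset.monotone_filter_right _ fun _ _ hx => hx.trans_le h)

theorem countLt_le_card (S : Finset ℕ) (t : ℕ) : countLt S t ≤ S.card :=
  Finset.card_filter_le _ _

theorem countLt_lt_iff {S : Finset ℕ} {s t : ℕ} (hs : s ∈ S) :
    countLt S s < countLt S t ↔ s < t := by
  constructor
  · intro h
    by_contra hst
    exact (countLt_mono S (not_lt.1 hst)).not_gt h
  · intro h
    have h1 := countLt_mono S (Nat.succ_le_of_lt h)
    have h2 := countLt_succ S s
    rw [if_pos hs] at h2
    rw [Nat.succ_eq_add_one] at h1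
    omega

theorem countLt_of_subset_range {S : Finset ℕ} {m : ℕ} (h : S ⊆ Finset.range m) :
    countLt S m = S.card := by
  rw [countLt, Finset.filter_true_of_mem fun x hx => Finset.mem_range.1 (h hx)]

theorem countLt_add_countLt_sdiff (O : Finset ℕ) {m t : ℕ} (ht : t ≤ m) :
    countLt O t + countLt (Finset.range m \ O) t = t := by
  induction t with
  | zero => simp [countLt]
  | succ t ih =>
    have := ih (by omega)
    rw [countLt_succ, countLt_succ]
    have hm : t ∈ Finset.range m := Finset.mem_range.2 (by omega)
    by_cases h : t ∈ O <;> simp [h, hm] <;> omega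

/-- The vertex reached after `t` steps of the path with east steps `O` among `2 n` steps. -/
def wordVertex (n : ℕ) (O : Finset ℕ) (t : ℕ) : ℕ × ℕ :=
  (countLt O t, n - countLt (Finset.range (2 * n) \ O) t)

/-- The board below the path with east steps `O`. -/
def wordShape (n : ℕ) (O : Finset ℕ) : Finset (ℕ × ℕ) :=
  (Finset.range (2 * n + 1)).biUnion fun t => Gam (wordVertex n O t)

theorem mem_Gam {V p : ℕ × ℕ} : p ∈ Gam V ↔ p.1 < V.1 ∧ p.2 < V.2 := by
  simp [Gam]

theorem mem_wordShape {n : ℕ} {O : Finset ℕ} {p : ℕ × ℕ} :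
    p ∈ wordShape n O ↔ ∃ t ≤ 2 * n, p.1 < (wordVertex n O t).1 ∧ p.2 < (wordVertex n O t).2 := by
  simp [wordShape, mem_Gam]

theorem mem_border {n : ℕ} {F : Finset (ℕ × ℕ)} {V : ℕ × ℕ} :
    V ∈ border n F ↔ (V.1 ≤ n ∧ V.2 ≤ n) ∧ Gam V ⊆ F ∧ V ∉ F := by
  simp [border]

section Word

variable {n : ℕ} {O : Finset ℕ}

theorem card_range_sdiff (hO : O ⊆ Finset.range (2 * n)) (hcard : O.card = n) :
    (Finset.range (2 * n) \ O).card = n := by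
  rw [Finset.card_sdiff_of_subset hO, Finset.card_range, hcard]
  omega

theorem wordVertex_add (hO : O ⊆ Finset.range (2 * n)) (hcard : O.card = n) {t : ℕ}
    (ht : t ≤ 2 * n) : (wordVertex n O t).1 + n = (wordVertex n O t).2 + t := by
  have h1 := countLt_add_countLt_sdiff O ht
  have h2 := countLt_le_card (Finset.range (2 * n) \ O) t
  rw [card_range_sdiff hO hcard] at h2
  simp only [wordVertex]
  omega

theorem wordVertex_fst_mono {s t : ℕ} (h : s ≤ t) :
    (wordVertex n O s).1 ≤ (wordVertex n O t).1 := countLt_mono _ h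

theorem wordVertex_snd_anti {s t : ℕ} (h : s ≤ t) :
    (wordVertex n O t).2 ≤ (wordVertex n O s).2 := Nat.sub_le_sub_left (countLt_mono _ h) _

theorem wordVertex_notMem_wordShape (t : ℕ) : wordVertex n O t ∉ wordShape n O := by
  rw [mem_wordShape]
  rintro ⟨s, -, h1, h2⟩
  rcases le_total s t with h | h
  · exact (wordVertex_fst_mono h).not_gt h1
  · exact (wordVertex_snd_anti h).not_gt h2

theorem wordVertex_mem_border (hcard : O.card = n) {t : ℕ} (ht : t ≤ 2 * n) :
    wordVertex n O t ∈ border n (wordShape n O) := by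
  refine mem_border.2 ⟨⟨?_, Nat.sub_le _ _⟩, fun p hp => ?_, wordVertex_notMem_wordShape t⟩
  · exact (countLt_le_card O t).trans hcard.le
  · exact mem_wordShape.2 ⟨t, ht, mem_Gam.1 hp⟩

/-- Each step raises `x - y` by one, so `V` lies on the same diagonal as the path vertex at time `n
+ V.1 - V.2`. Distinct points of a diagonal are strictly comparable in both coordinates, and either
comparison contradicts that both points are on the border. -/
theorem border_wordShape (hO : O ⊆ Finset.range (2 * n)) (hcard : O.card = n) :
    border n (wordShape n O) = (Finset.range (2 * n + 1)).image (wordVertex n O) := by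
  ext V
  simp only [Finset.mem_image, Finset.mem_range, Nat.lt_succ_iff]
  constructor
  · intro hV
    obtain ⟨⟨h1, h2⟩, h3, h4⟩ := mem_border.1 hV
    have ht : n + V.1 - V.2 ≤ 2 * n := by omega
    refine ⟨n + V.1 - V.2, ht, ?_⟩
    have hdiag := wordVertex_add hO hcard ht
    set W := wordVertex n O (n + V.1 - V.2) with hW
    have hle : ¬ (V.1 < W.1 ∧ V.2 < W.2) := fun h => h4 (mem_wordShape.2 ⟨_, ht, h⟩)
    have hge : ¬ (W.1 < V.1 ∧ W.2 < V.2) := fun h =>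
      wordVertex_notMem_wordShape _ (h3 (mem_Gam.2 h))
    exact Prod.ext (by omega) (by omega)
  · rintro ⟨t, ht, rfl⟩
    exact wordVertex_mem_border hcard ht

theorem wordVertex_injOn (hO : O ⊆ Finset.range (2 * n)) (hcard : O.card = n) :
    Set.InjOn (wordVertex n O) (Finset.range (2 * n + 1)) := by
  intro s hs t ht hst
  simp only [Finset.coe_range, Set.mem_Iio] at hs ht
  have h1 := wordVertex_add hO hcard (Nat.lt_succ_iff.1 hs)
  have h2 := wordVertex_add hO hcard (Nat.lt_succ_iff.1 ht)
  rw [hst] at h1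
  omega

/-- The shape determines the border, the border is the path, and the time of each vertex is read off
from its diagonal. -/
theorem wordShape_injective {O' : Finset ℕ} (hO : O ⊆ Finset.range (2 * n)) (hcard : O.card = n)
    (hO' : O' ⊆ Finset.range (2 * n)) (hcard' : O'.card = n)
    (h : wordShape n O = wordShape n O') : O = O' := by
  have key : ∀ t ≤ 2 * n, countLt O t = countLt O' t := by
    intro t ht
    have h1 := wordVertex_mem_border hcard ht
    rw [h, border_wordShape hO' hcard', Finset.mem_image] at h1
    obtain ⟨s, hs, hst⟩ := h1
    have hs := Nat.lt_succ_iff.1 (Finset.mem_range.1 hs)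
    have h1 := wordVertex_add hO hcard ht
    have h2 := wordVertex_add hO' hcard' hs
    obtain rfl : s = t := by
      rw [hst] at h2
      omega
    exact (congrArg Prod.fst hst).symm
  ext t
  by_cases ht : t < 2 * n
  · have h1 := key t ht.le
    have h2 := key (t + 1) ht
    rw [countLt_succ, countLt_succ, h1] at h2
    by_cases a : t ∈ O <;> by_cases b : t ∈ O' <;> simp_all
  · exact ⟨fun h => absurd (Finset.mem_range.1 (hO h)) ht,
      fun h => absurd (Finset.mem_range.1 (hO' h)) ht⟩

theorem openArcs_add_countLt {C : Finset ℕ} {m : ℕ}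
    (h : ∀ t ≤ m, countLt C t ≤ countLt O t) (hdisj : Disjoint O C) :
    openArcs O C m + countLt C m = countLt O m := by
  induction m with
  | zero => simp [openArcs, countLt]
  | succ m ih =>
    have h1 := ih fun t ht => h t (by omega)
    have h2 := h (m + 1) le_rfl
    rw [countLt_succ, countLt_succ] at h2
    rw [openArcs, countLt_succ, countLt_succ]
    have h3 : m ∈ O → m ∉ C := fun hm => Finset.disjoint_left.1 hdisj hm
    by_cases a : m ∈ O <;> by_cases b : m ∈ C <;> simp_all <;> omega

theorem vertexHeight_wordVertex (h : ∀ t ≤ 2 * n, n ≤ (wordVertex n O t).1 + (wordVertex n O t).2)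
    (hO : O ⊆ Finset.range (2 * n)) (hcard : O.card = n) {t : ℕ} (ht : t ≤ 2 * n) :
    vertexHeight n (wordVertex n O t) = openArcs O (Finset.range (2 * n) \ O) t := by
  have hD : ∀ s, countLt (Finset.range (2 * n) \ O) s ≤ n := fun s =>
    (countLt_le_card _ s).trans (card_range_sdiff hO hcard).le
  have := openArcs_add_countLt (O := O) (C := Finset.range (2 * n) \ O) (m := t)
    (fun s hs => by have h1 := h s (hs.trans ht); have := hD s; simp only [wordVertex] at h1; omega)
    Finset.disjoint_sdiff
  have := hD t
  simp only [vertexHeight, wordVertex]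
  omega

theorem openArcs_lt_of_weight_ne_zero {C : Finset ℕ} {m : ℕ} (h : weight O C m ≠ 0) :
    ∀ t ≤ m, openArcs O C t < 5 := by
  induction m with
  | zero => simp [openArcs]
  | succ m ih =>
    rw [weight, mul_ne_zero_iff] at h
    have h1 : weight O C m ≠ 0 := by
      have := h.1
      split_ifs at this
      · exact absurd rfl this
      · exact this
    intro t ht
    rcases Nat.le_succ_iff.1 ht with ht | rfl
    · exact ih h1 t ht
    · have h2 := ih h1 m le_rfl
      have h3 := h.2
      simp only [openArcs]
      by_cases hm : m ∈ O
      · simp only [hm, if_true] at h3 ⊢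
        generalize (openArcs O C m - if m ∈ C then 1 else 0) = k at h3 ⊢
        by_contra hk
        obtain ⟨l, rfl⟩ : ∃ l, k = l + 4 := ⟨k - 4, by omega⟩
        simp [growth] at h3
      · simp only [hm, if_false]
        omega

/-- Factors 2 arise when the height rises to 2 or to 3. The factor for rising to 3 pays in advance
for the return to 2, hence the extra 2 while the height is at least 3. -/
theorem weight_eq_two_pow {C : Finset ℕ} {m : ℕ} (hlt : ∀ t ≤ m, openArcs O C t < 5)
    (hmem : ∀ t < m, t ∈ C ↔ t ∉ O) (hpos : ∀ t < m, t ∈ C → openArcs O C t ≠ 0) :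
    weight O C m = 2 ^ ((Finset.range (m + 1)).filter fun t => openArcs O C t = 2).card *
      if 3 ≤ openArcs O C m then 2 else 1 := by
  induction m with
  | zero => simp [weight, openArcs, Finset.filter_singleton]
  | succ m ih =>
    have h1 := ih (fun t ht => hlt t (by omega)) (fun t ht => hmem t (by omega))
      fun t ht => hpos t (by omega)
    have h2 := hmem m (Nat.lt_succ_self m)
    have h3 := hpos m (Nat.lt_succ_self m)
    have h4 := hlt (m + 1) le_rfl
    rw [Finset.range_add_one, Finset.filter_insert, weight, h1]
    have hc : ∀ p : Prop, [Decidable p] → (if p then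
        insert (m + 1) ((Finset.range (m + 1)).filter fun t => openArcs O C t = 2)
        else (Finset.range (m + 1)).filter fun t => openArcs O C t = 2).card =
        ((Finset.range (m + 1)).filter fun t => openArcs O C t = 2).card +
          if p then 1 else 0 := by
      intro p _
      split_ifs
      · rw [Finset.card_insert_of_notMem (by simp)]
      · rfl
    rw [hc, pow_add]
    generalize 2 ^ ((Finset.range (m + 1)).filter fun t => openArcs O C t = 2).card = N
    rw [openArcs] at h4 ⊢
    generalize openArcs O C m = k at *
    by_cases hm : m ∈ O
    · have hC : m ∉ C := fun h => h2.1 h hm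
      simp only [hm, hC, if_true, if_false, false_and, Nat.sub_zero] at h4 ⊢
      have : k < 4 := by omega
      interval_cases k <;> simp [growth]
    · have hC : m ∈ C := h2.2 hm
      have := h3 hC
      simp only [hm, hC, if_true, if_false, true_and, add_zero] at h4 ⊢
      have : k < 6 := by omega
      interval_cases k <;> simp at *

/-- Arrangements below a path that stays weakly above the diagonal. -/
theorem card_diagrams_word (h : ∀ t ≤ 2 * n, n ≤ (wordVertex n O t).1 + (wordVertex n O t).2)
    (hO : O ⊆ Finset.range (2 * n)) (hcard : O.card = n) :
    (diagrams O (Finset.range (2 * n) \ O)).card =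
      if borderHeight n (wordShape n O) < 5 then 2 ^ eta n (wordShape n O) else 0 := by
  set C := Finset.range (2 * n) \ O with hC
  have hht : ∀ t ≤ 2 * n, vertexHeight n (wordVertex n O t) = openArcs O C t := fun t ht =>
    vertexHeight_wordVertex h hO hcard ht
  have hle : ∀ t ≤ 2 * n, countLt C t ≤ countLt O t := fun t ht => by
    have h1 := h t ht
    have h2 := countLt_le_card C t
    rw [hC, card_range_sdiff hO hcard, ← hC] at h2
    simp only [wordVertex, ← hC] at h1
    omega
  have hadd : ∀ t ≤ 2 * n, openArcs O C t + countLt C t = countLt O t := fun t ht =>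
    openArcs_add_countLt (fun s hs => hle s (hs.trans ht)) Finset.disjoint_sdiff
  have hfin : openArcs O C (2 * n) = 0 := by
    have := hadd (2 * n) le_rfl
    rw [countLt_of_subset_range hO, countLt_of_subset_range Finset.sdiff_subset,
      card_range_sdiff hO hcard] at this
    omega
  have heta : eta n (wordShape n O) =
      ((Finset.range (2 * n + 1)).filter fun t => openArcs O C t = 2).card := by
    rw [eta, border_wordShape hO hcard, Finset.filter_image, Finset.card_image_of_injOn]
    · refine congrArg _ (Finset.filter_congr fun t ht => ?_)
      rw [hht t (Nat.lt_succ_iff.1 (Finset.mem_range.1 ht))]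
    · exact (wordVertex_injOn hO hcard).mono (Finset.coe_subset.2 (Finset.filter_subset _ _))
  have hbh : borderHeight n (wordShape n O) < 5 ↔ ∀ t ≤ 2 * n, openArcs O C t < 5 := by
    rw [borderHeight, border_wordShape hO hcard, Finset.sup_lt_iff (by norm_num)]
    simp only [Finset.forall_mem_image, Finset.mem_range, Nat.lt_succ_iff]
    exact forall₂_congr fun t ht => by rw [hht t ht]
  rw [card_diagrams (m := 2 * n) (fun i hi => Finset.mem_range.1 (hO hi))
    (fun j hj => Finset.mem_range.1 (Finset.sdiff_subset hj)), if_pos hfin, heta]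
  split_ifs with h5
  · rw [weight_eq_two_pow (hbh.1 h5), hfin]
    · simp
    · intro t ht
      simp [hC, ht]
    -- A closer at height 0 would take the path below the diagonal.
    · intro t ht htC h0
      have h1 := hadd t ht.le
      have h2 := hle (t + 1) ht
      have h3 : t ∉ O := (Finset.mem_sdiff.1 htC).2
      rw [countLt_succ, countLt_succ, if_pos htC, if_neg h3] at h2
      omega
  · by_contra hw
    exact h5 (hbh.2 (openArcs_lt_of_weight_ne_zero hw))

end Word

/-! ### The border of a board as a lattice path -/

section Board

variable {n : ℕ} {F : Finset (ℕ × ℕ)}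

/-- The border of a board, traced from `(0, n)`. -/
def boardPath (n : ℕ) (F : Finset (ℕ × ℕ)) : ℕ → ℕ × ℕ
  | 0 => (0, n)
  | t + 1 => let V := boardPath n F t
    if (V.1, V.2 - 1) ∈ F then (V.1 + 1, V.2) else (V.1, V.2 - 1)

/-- The east steps of the border of a board. -/
def boardWord (n : ℕ) (F : Finset (ℕ × ℕ)) : Finset ℕ :=
  (Finset.range (2 * n)).filter fun t => ((boardPath n F t).1, (boardPath n F t).2 - 1) ∈ F

theorem IsBoard.boardPath_mem_border (h : IsBoard n F) {t : ℕ} (ht : t ≤ 2 * n) :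
    boardPath n F t ∈ border n F ∧ (boardPath n F t).1 + n = (boardPath n F t).2 + t := by
  have hsq : ∀ x y, (x, y) ∈ F → x < n ∧ y < n := fun x y hxy =>
    mem_Gam.1 (h.subset_square hxy)
  have hlow : ∀ {x y x' y'}, (x, y) ∈ F → x' ≤ x → y' ≤ y → (x', y') ∈ F := fun hxy hx hy =>
    h.lower (Prod.mk_le_mk.2 ⟨hx, hy⟩) hxy
  induction t with
  | zero =>
    refine ⟨mem_border.2 ⟨⟨Nat.zero_le _, le_rfl⟩, fun p hp => ?_, fun hp => ?_⟩, by
      simp [boardPath]⟩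
    · exact absurd (mem_Gam.1 hp).1 (Nat.not_lt_zero _)
    · exact (hsq _ _ hp).2.false
  | succ t ih =>
    obtain ⟨hV, hadd⟩ := ih (by omega)
    obtain ⟨⟨h1, h2⟩, h3, h4⟩ := mem_border.1 hV
    rw [boardPath]
    generalize boardPath n F t = V at *
    obtain ⟨a, b⟩ := V
    simp only at h1 h2 hadd
    -- This makes `b - 1` a genuine predecessor: before time `2 * n` a vertex with `b = 0` has `a <
    -- n`, and column `a` is not empty.
    have hb : b ≠ 0 := by
      rintro rfl
      obtain ⟨y, hy⟩ := h.column_nonempty a (by omega)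
      exact h4 (hlow hy le_rfl (Nat.zero_le y))
    split_ifs with hF
    · refine ⟨mem_border.2 ⟨⟨(hsq _ _ hF).1, h2⟩, fun p hp => ?_, fun hp => ?_⟩, by
        simp only; omega⟩
      · have hp := mem_Gam.1 hp
        exact hlow hF (Nat.lt_succ_iff.1 hp.1) (Nat.le_sub_one_of_lt hp.2)
      · exact h4 (hlow hp (Nat.le_succ a) le_rfl)
    · refine ⟨mem_border.2 ⟨⟨h1, by simp only; omega⟩, fun p hp => ?_, hF⟩, by
        simp only; omega⟩
      have hp := mem_Gam.1 hp
      exact h3 (mem_Gam.2 ⟨hp.1, by simp only at hp ⊢; omega⟩)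

theorem countLt_boardWord {t : ℕ} (ht : t ≤ 2 * n) :
    countLt (boardWord n F) t = (boardPath n F t).1 := by
  induction t with
  | zero => simp [countLt, boardPath]
  | succ t ih =>
    rw [countLt_succ, ih (by omega), boardPath]
    have : t ∈ boardWord n F ↔ ((boardPath n F t).1, (boardPath n F t).2 - 1) ∈ F := by
      simp only [boardWord, Finset.mem_filter, Finset.mem_range, and_iff_right_iff_imp]
      exact fun _ => by omega
    simp only [this]
    split_ifs <;> rfl

theorem boardWord_subset : boardWord n F ⊆ Finset.range (2 * n) := Finset.filter_subset _ _

theorem IsBoard.card_boardWord (h : IsBoard n F) : (boardWord n F).card = n := by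
  rw [← countLt_of_subset_range boardWord_subset, countLt_boardWord le_rfl]
  obtain ⟨h1, h2⟩ := h.boardPath_mem_border (le_refl (2 * n))
  have := (mem_border.1 h1).1
  omega

theorem IsBoard.wordVertex_boardWord (h : IsBoard n F) {t : ℕ} (ht : t ≤ 2 * n) :
    wordVertex n (boardWord n F) t = boardPath n F t := by
  have h1 := wordVertex_add boardWord_subset h.card_boardWord ht
  have h2 : (wordVertex n (boardWord n F) t).1 = _ := countLt_boardWord ht
  have h3 := (h.boardPath_mem_border ht).2
  exact Prod.ext h2 (by omega)

theorem IsBoard.wordShape_boardWord (h : IsBoard n F) : wordShape n (boardWord n F) = F := by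
  ext p
  rw [mem_wordShape]
  constructor
  · rintro ⟨t, ht, hp⟩
    rw [h.wordVertex_boardWord ht] at hp
    exact (mem_border.1 (h.boardPath_mem_border ht).1).2.1 (mem_Gam.2 hp)
  · intro hp
    have hsq := mem_Gam.1 (h.subset_square hp)
    have ht : n + p.1 - p.2 ≤ 2 * n := by simp only at hsq; omega
    -- This border vertex is on the diagonal of `p`. If it were not strictly above and to the right
    -- of `p`, it would be weakly below and to the left, hence itself a square of `F`.
    refine ⟨n + p.1 - p.2, ht, ?_⟩
    rw [h.wordVertex_boardWord ht]
    obtain ⟨h1, h2⟩ := h.boardPath_mem_border ht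
    have h3 := (mem_border.1 h1).2.2
    by_contra hc
    refine h3 (h.lower (show _ ≤ p from Prod.mk_le_mk.2 ⟨?_, ?_⟩) hp) <;>
      · simp only at hsq
        omega

end Board

/-! ### Matchings as arc diagrams -/

/-- The pairs of a set of pairs of points, as pairs of natural numbers. -/
def arcs {m : ℕ} (M : Finset (Fin m × Fin m)) : Finset (ℕ × ℕ) :=
  M.image (Prod.map Fin.val Fin.val)

theorem mem_arcs {m : ℕ} {M : Finset (Fin m × Fin m)} {i j : ℕ} :
    (i, j) ∈ arcs M ↔ ∃ (hi : i < m) (hj : j < m), (⟨i, hi⟩, ⟨j, hj⟩) ∈ M := by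
  simp only [arcs, Finset.mem_image, Prod.exists, Prod.map_apply, Prod.mk.injEq]
  constructor
  · rintro ⟨a, b, hab, rfl, rfl⟩
    exact ⟨a.2, b.2, hab⟩
  · rintro ⟨hi, hj, h⟩
    exact ⟨_, _, h, rfl, rfl⟩

theorem val_mem_arcs {m : ℕ} {M : Finset (Fin m × Fin m)} {i j : Fin m} :
    ((i : ℕ), (j : ℕ)) ∈ arcs M ↔ (i, j) ∈ M := by
  simp [mem_arcs]

theorem arcs_injective {m : ℕ} : Function.Injective (arcs (m := m)) :=
  Finset.image_injective (Fin.val_injective.prodMap Fin.val_injective)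

theorem exists_arcs_eq {m : ℕ} {A : Finset (ℕ × ℕ)} (h : ∀ i j, (i, j) ∈ A → i < m ∧ j < m) :
    ∃ M : Finset (Fin m × Fin m), arcs M = A := by
  refine ⟨Finset.univ.filter fun e => ((e.1 : ℕ), (e.2 : ℕ)) ∈ A, ?_⟩
  ext ⟨i, j⟩
  rw [mem_arcs]
  simp only [Finset.mem_filter, Finset.mem_univ, true_and, exists_prop]
  exact ⟨fun hij => hij.2.2, fun hij => ⟨(h i j hij).1, (h i j hij).2, hij⟩⟩

theorem IsDiagram.image_fst {O C : Finset ℕ} {A : Finset (ℕ × ℕ)} (h : IsDiagram O C A) :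
    A.image Prod.fst = O := by
  ext i
  simp only [Finset.mem_image, Prod.exists, exists_and_right, exists_eq_right]
  exact ⟨fun ⟨j, hj⟩ => (h.mem i j hj).1, h.right i⟩

theorem IsDiagram.image_snd {O C : Finset ℕ} {A : Finset (ℕ × ℕ)} (h : IsDiagram O C A) :
    A.image Prod.snd = C := by
  ext j
  simp only [Finset.mem_image, Prod.exists, exists_eq_right]
  exact ⟨fun ⟨i, hi⟩ => (h.mem i j hi).2.1, h.left j⟩

section Matching

variable {n : ℕ} {M : Finset (Fin (2 * n) × Fin (2 * n))}

/-- The openers of a matching. -/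
def openers (M : Finset (Fin (2 * n) × Fin (2 * n))) : Finset ℕ := (arcs M).image Prod.fst

/-- The closers of a matching. -/
def closers (M : Finset (Fin (2 * n) × Fin (2 * n))) : Finset ℕ :=
  Finset.range (2 * n) \ openers M

theorem mem_openers {i : ℕ} : i ∈ openers M ↔ ∃ j, (i, j) ∈ arcs M := by
  simp [openers]

theorem openers_subset : openers M ⊆ Finset.range (2 * n) := by
  intro i hi
  obtain ⟨j, hj⟩ := mem_openers.1 hi
  exact Finset.mem_range.2 (mem_arcs.1 hj).1

theorem IsMatching.isDiagram (h : IsMatching n M) : IsDiagram (openers M) (closers M) (arcs M) where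
  mem i j hij := by
    obtain ⟨hi, hj, hij'⟩ := mem_arcs.1 hij
    refine ⟨mem_openers.2 ⟨j, hij⟩, Finset.mem_sdiff.2 ⟨Finset.mem_range.2 hj, fun hjO => ?_⟩,
      h.lt _ hij'⟩
    obtain ⟨k, hjk⟩ := mem_openers.1 hjO
    obtain ⟨_, hk, hjk'⟩ := mem_arcs.1 hjk
    have := (h.existsUnique ⟨j, hj⟩).unique ⟨hij', Or.inr rfl⟩ ⟨hjk', Or.inl rfl⟩
    have h1 : i = j := by simpa using congrArg Prod.fst this
    exact (h.lt _ hij').ne (Fin.ext h1)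
  right i hi := mem_openers.1 hi
  left j hj := by
    obtain ⟨hj, hjO⟩ := Finset.mem_sdiff.1 hj
    obtain ⟨⟨a, b⟩, ⟨he, hab⟩, -⟩ := h.existsUnique ⟨j, Finset.mem_range.1 hj⟩
    rcases hab with hab | hab
    · subst hab
      exact absurd (mem_openers.2 ⟨b, val_mem_arcs.2 he⟩) hjO
    · subst hab
      exact ⟨a, val_mem_arcs.2 he⟩
  right_unique i j k hij hik := by
    obtain ⟨hi, hj, hij⟩ := mem_arcs.1 hij
    obtain ⟨_, hk, hik⟩ := mem_arcs.1 hik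
    simpa using (h.existsUnique ⟨i, hi⟩).unique ⟨hij, Or.inl rfl⟩ ⟨hik, Or.inl rfl⟩
  left_unique i j k hik hjk := by
    obtain ⟨hi, hk, hik⟩ := mem_arcs.1 hik
    obtain ⟨hj, _, hjk⟩ := mem_arcs.1 hjk
    simpa using (h.existsUnique ⟨k, hk⟩).unique ⟨hik, Or.inr rfl⟩ ⟨hjk, Or.inr rfl⟩

theorem isMatching_of_isDiagram {O : Finset ℕ}
    (h : IsDiagram O (Finset.range (2 * n) \ O) (arcs M)) : IsMatching n M where
  lt e he := (h.mem _ _ (val_mem_arcs.2 he)).2.2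
  existsUnique v := by
    by_cases hv : (v : ℕ) ∈ O
    · obtain ⟨j, hj⟩ := h.right v hv
      obtain ⟨_, hj', hM⟩ := mem_arcs.1 hj
      refine ⟨(v, ⟨j, hj'⟩), ⟨hM, Or.inl rfl⟩, ?_⟩
      rintro ⟨a, b⟩ ⟨he, hab⟩
      rcases hab with hab | hab
      · subst hab
        exact Prod.ext rfl (Fin.ext (h.right_unique _ _ _ (val_mem_arcs.2 he) hj))
      · subst hab
        exact absurd hv (Finset.mem_sdiff.1 (h.mem _ _ (val_mem_arcs.2 he)).2.1).2
    · obtain ⟨i, hi⟩ := h.left v (Finset.mem_sdiff.2 ⟨Finset.mem_range.2 v.2, hv⟩)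
      obtain ⟨hi', _, hM⟩ := mem_arcs.1 hi
      refine ⟨(⟨i, hi'⟩, v), ⟨hM, Or.inr rfl⟩, ?_⟩
      rintro ⟨a, b⟩ ⟨he, hab⟩
      rcases hab with hab | hab
      · subst hab
        exact absurd (h.mem _ _ (val_mem_arcs.2 he)).1 hv
      · subst hab
        exact Prod.ext (Fin.ext (h.left_unique _ _ _ (val_mem_arcs.2 he) hi)) rfl

theorem IsMatching.card_openers (h : IsMatching n M) : (openers M).card = n := by
  have h1 := h.isDiagram.card_openers_le
  have h2 := h.isDiagram.card_closers_le (2 * n)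
  have h3 := Finset.card_filter_le (openers M) (· < 2 * n)
  have h5 : (closers M).filter (· < 2 * n + 1) = closers M :=
    Finset.filter_true_of_mem fun j hj =>
      (Finset.mem_range.1 (Finset.sdiff_subset hj)).trans (Nat.lt_succ_self _)
  rw [h5] at h2
  have h4 : (closers M).card + (openers M).card = 2 * n := by
    rw [closers, Finset.card_sdiff_add_card_eq_card openers_subset, Finset.card_range]
  omega

theorem IsMatching.pathVertex_eq (h : IsMatching n M) (t : ℕ) :
    pathVertex n M t = wordVertex n (openers M) t := by
  have h1 : (M.filter fun e => (e.1 : ℕ) < t).card = countLt (openers M) t := by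
    have : (openers M).filter (· < t) =
        (M.filter fun e => (e.1 : ℕ) < t).image fun e => (e.1 : ℕ) := by
      rw [openers, arcs, Finset.image_image, Finset.filter_image]
      rfl
    rw [countLt, this, Finset.card_image_of_injOn]
    rintro ⟨a, b⟩ he ⟨c, d⟩ hf hac
    obtain rfl : a = c := Fin.ext hac
    have hb := h.isDiagram.right_unique _ _ _
      (val_mem_arcs.2 (Finset.mem_filter.1 (Finset.mem_coe.1 he)).1)
      (val_mem_arcs.2 (Finset.mem_filter.1 (Finset.mem_coe.1 hf)).1)
    exact Prod.ext rfl (Fin.ext hb)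
  have h2 : (M.filter fun e => (e.2 : ℕ) < t).card = countLt (closers M) t := by
    have : (closers M).filter (· < t) =
        (M.filter fun e => (e.2 : ℕ) < t).image fun e => (e.2 : ℕ) := by
      rw [← h.isDiagram.image_snd, arcs, Finset.image_image, Finset.filter_image]
      rfl
    rw [countLt, this, Finset.card_image_of_injOn]
    rintro ⟨a, b⟩ he ⟨c, d⟩ hf hac
    obtain rfl : b = d := Fin.ext hac
    have hb := h.isDiagram.left_unique _ _ _
      (val_mem_arcs.2 (Finset.mem_filter.1 (Finset.mem_coe.1 he)).1)
      (val_mem_arcs.2 (Finset.mem_filter.1 (Finset.mem_coe.1 hf)).1)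
    exact Prod.ext (Fin.ext hb) rfl
  rw [pathVertex, wordVertex, h1, h2, closers]

theorem IsMatching.shape_eq (h : IsMatching n M) : shape n M = wordShape n (openers M) := by
  simp only [shape, wordShape, h.pathVertex_eq]

theorem IsMatching.mem_rooks (h : IsMatching n M) {p : ℕ × ℕ} : p ∈ rooks n M ↔
    ∃ i j, (i, j) ∈ arcs M ∧
      p = ((wordVertex n (openers M) i).1, (wordVertex n (openers M) (j + 1)).2) := by
  simp only [rooks, Finset.mem_image, h.pathVertex_eq]
  constructor
  · rintro ⟨e, he, rfl⟩
    exact ⟨e.1, e.2, val_mem_arcs.2 he, rfl⟩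
  · rintro ⟨i, j, hij, rfl⟩
    obtain ⟨hi, hj, hM⟩ := mem_arcs.1 hij
    exact ⟨_, hM, rfl⟩

theorem IsMatching.fst_lt_iff (h : IsMatching n M) {i j t : ℕ} (hij : (i, j) ∈ arcs M) :
    (wordVertex n (openers M) i).1 < (wordVertex n (openers M) t).1 ↔ i < t :=
  countLt_lt_iff (h.isDiagram.mem _ _ hij).1

/-- Together with `fst_lt_iff` this says that the rook of `(i, j)` lies below the vertex at time `t`
exactly when `i < t ≤ j`, that is, when the arc is open there. -/
theorem IsMatching.snd_lt_iff (h : IsMatching n M) {i j t : ℕ} (hij : (i, j) ∈ arcs M) :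
    (wordVertex n (openers M) (j + 1)).2 < (wordVertex n (openers M) t).2 ↔ t ≤ j := by
  have hj := (h.isDiagram.mem _ _ hij).2.1
  have h1 := countLt_succ (closers M) j
  rw [if_pos hj] at h1
  have h2 := countLt_le_card (closers M) (j + 1)
  have h3 : (closers M).card = n := card_range_sdiff openers_subset h.card_openers
  change n - countLt (closers M) (j + 1) < n - countLt (closers M) t ↔ _
  constructor
  · intro hlt
    by_contra htj
    have := countLt_mono (closers M) (show j + 1 ≤ t by omega)
    omega
  · intro htj
    have := countLt_mono (closers M) htj
    omega

/-- Rooks below a common vertex are arcs open at a common moment. Later closers have lower rows, so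
the order of the closers is the reverse of the pattern. -/
theorem IsMatching.matchingAvoids_iff (h : IsMatching n M) (τ : Equiv.Perm (Fin 3)) :
    MatchingAvoids n M τ ↔ ¬ ∃ i j : Fin 3 → ℕ, StrictMono i ∧ (∀ a, (i a, j a) ∈ arcs M) ∧
      (∀ a b, i a < j b) ∧ ∀ a b, j b < j a ↔ τ a < τ b := by
  rw [MatchingAvoids, PlacementAvoids, ← not_iff_not, not_not]
  push Not
  rw [h.shape_eq]
  constructor
  · rintro ⟨V, hV, x, y, hx, hmem, hy⟩
    obtain ⟨-, hV, -⟩ := mem_border.1 hV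
    choose i j hij hxy using fun a => h.mem_rooks.1 (Finset.mem_inter.1 (hmem a)).1
    have hG : ∀ a, x a < V.1 ∧ y a < V.2 := fun a =>
      mem_Gam.1 (Finset.mem_inter.1 (hmem a)).2
    have hG0 := hG 0
    -- The upper right square of `Gam V` lies below some path vertex, and then so does all of `Gam
    -- V`. The square exists because `Gam V` contains a rook.
    obtain ⟨t, -, ht⟩ := mem_wordShape.1 (hV (mem_Gam.2
      (show (V.1 - 1, V.2 - 1).1 < V.1 ∧ (V.1 - 1, V.2 - 1).2 < V.2 by simp only; omega)))
    have hx' : ∀ a, x a = (wordVertex n (openers M) (i a)).1 := fun a =>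
      congrArg Prod.fst (hxy a)
    have hy' : ∀ a, y a = (wordVertex n (openers M) (j a + 1)).2 := fun a =>
      congrArg Prod.snd (hxy a)
    have hit : ∀ a, i a < t := fun a => (h.fst_lt_iff (hij a)).1 (by
      rw [← hx' a]; have := hG a; simp only at ht; omega)
    have hjt : ∀ a, t ≤ j a := fun a => (h.snd_lt_iff (hij a)).1 (by
      rw [← hy' a]; have := hG a; simp only at ht; omega)
    refine ⟨i, j, fun a b hab => ?_, hij, fun a b => (hit a).trans_le (hjt b), fun a b => ?_⟩
    · have := hx hab
      rwa [hx', hx', h.fst_lt_iff (hij a)] at this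
    · rw [← hy, hy', hy', h.snd_lt_iff (hij a), Nat.succ_le_iff]
  · rintro ⟨i, j, hi, hij, hlt, hj⟩
    have hi2 : i 2 < 2 * n := (mem_arcs.1 (hij 2)).1
    have hile : ∀ a, i a < i 2 + 1 := fun a =>
      Nat.lt_succ_iff.2 (hi.monotone (Fin.le_last a))
    -- The vertex just after the last of the three openers, where none of the three arcs has ended.
    refine ⟨_, wordVertex_mem_border h.card_openers (show i 2 + 1 ≤ 2 * n from hi2),
      fun a => (wordVertex n (openers M) (i a)).1,
      fun a => (wordVertex n (openers M) (j a + 1)).2, fun a b hab => ?_, fun a => ?_,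
      fun a b => ?_⟩
    · exact (h.fst_lt_iff (hij a)).2 (hi hab)
    · refine Finset.mem_inter.2 ⟨h.mem_rooks.2 ⟨_, _, hij a, rfl⟩, mem_Gam.2 ⟨?_, ?_⟩⟩
      · exact (h.fst_lt_iff (hij a)).2 (hile a)
      · exact (h.snd_lt_iff (hij a)).2 (hlt 2 a)
    · rw [h.snd_lt_iff (hij a), ← hj, Nat.succ_le_iff]

theorem strictMono_vec {a b c : ℕ} (hab : a < b) (hbc : b < c) : StrictMono ![a, b, c] := by
  rw [Fin.strictMono_iff_lt_succ]
  intro i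
  fin_cases i
  · exact hab
  · exact hbc

theorem IsMatching.isSparse_iff (h : IsMatching n M) :
    IsSparse (arcs M) ↔ MatchingAvoids n M p123 ∧ MatchingAvoids n M p321 := by
  rw [h.matchingAvoids_iff, h.matchingAvoids_iff]
  constructor
  · rintro ⟨h1, h2⟩
    refine ⟨?_, ?_⟩
    · rintro ⟨i, j, hi, hij, hlt, hj⟩
      exact h2 (i 0) (i 1) (i 2) (j 2) (j 1) (j 0) (hi (by decide)) (hi (by decide)) (hlt _ _)
        ((hj 1 2).2 (by decide)) ((hj 0 1).2 (by decide)) (hij 0) (hij 1) (hij 2)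
    · rintro ⟨i, j, hi, hij, hlt, hj⟩
      exact h1 (i 0) (i 1) (i 2) (j 0) (j 1) (j 2) (hi (by decide)) (hi (by decide)) (hlt _ _)
        ((hj 1 0).2 (by decide)) ((hj 2 1).2 (by decide)) (hij 0) (hij 1) (hij 2)
  · rintro ⟨h1, h2⟩
    refine ⟨fun i₁ i₂ i₃ j₁ j₂ j₃ a b c d e f g k => h2 ?_,
      fun i₁ i₂ i₃ j₁ j₂ j₃ a b c d e f g k => h1 ?_⟩
    · refine ⟨![i₁, i₂, i₃], ![j₁, j₂, j₃], strictMono_vec a b, ?_, ?_, ?_⟩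
      · intro x; fin_cases x <;> assumption
      · intro x y; fin_cases x <;> fin_cases y <;> simp <;> omega
      · intro x y; fin_cases x <;> fin_cases y <;> simp [p321] <;> omega
    · refine ⟨![i₁, i₂, i₃], ![j₃, j₂, j₁], strictMono_vec a b, ?_, ?_, ?_⟩
      · intro x; fin_cases x <;> assumption
      · intro x y; fin_cases x <;> fin_cases y <;> simp <;> omega
      · intro x y; fin_cases x <;> fin_cases y <;> simp [p123] <;> omega

theorem mem_matchingsAvoiding : M ∈ matchingsAvoiding n p123 p321 ↔
    arcs M ∈ diagrams (openers M) (Finset.range (2 * n) \ openers M) := by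
  rw [mem_diagrams]
  constructor
  · rintro ⟨h, hav⟩
    exact ⟨h.isDiagram, h.isSparse_iff.2 hav⟩
  · rintro ⟨h, hs⟩
    have := isMatching_of_isDiagram h
    exact ⟨this, this.isSparse_iff.1 hs⟩

theorem exists_arcs_eq_of_mem_diagrams {O : Finset ℕ} {A : Finset (ℕ × ℕ)}
    (hO : O ⊆ Finset.range (2 * n)) (hA : A ∈ diagrams O (Finset.range (2 * n) \ O)) :
    ∃ M ∈ matchingsAvoiding n p123 p321, openers M = O ∧ arcs M = A := by
  have h := (mem_diagrams.1 hA).1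
  obtain ⟨M, rfl⟩ := exists_arcs_eq (m := 2 * n) (A := A) fun i j hij =>
    ⟨Finset.mem_range.1 (hO (h.mem i j hij).1),
      Finset.mem_range.1 (Finset.sdiff_subset (h.mem i j hij).2.1)⟩
  have hMO : openers M = O := h.image_fst
  exact ⟨M, mem_matchingsAvoiding.2 (hMO ▸ hA), hMO, rfl⟩

theorem ncard_matchings_of_openers {O : Finset ℕ} (hO : O ⊆ Finset.range (2 * n)) :
    {M | M ∈ matchingsAvoiding n p123 p321 ∧ openers M = O}.ncard =
      (diagrams O (Finset.range (2 * n) \ O)).card := by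
  rw [← Set.ncard_image_of_injective _ arcs_injective, ← Set.ncard_coe_finset]
  congr 1
  ext A
  constructor
  · rintro ⟨M, ⟨hM, rfl⟩, rfl⟩
    exact mem_matchingsAvoiding.1 hM
  · intro hA
    obtain ⟨M, hM, h1, h2⟩ := exists_arcs_eq_of_mem_diagrams hO hA
    exact ⟨M, ⟨hM, h1⟩, h2⟩

theorem ncard_matchingsAvoiding (n : ℕ) :
    (matchingsAvoiding n p123 p321).ncard = matchingCount (2 * n) 0 := by
  classical
  have : arcs '' matchingsAvoiding n p123 p321 = ((Finset.range (2 * n)).powerset.biUnion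
      fun O => diagrams O (Finset.range (2 * n) \ O) : Finset (Finset (ℕ × ℕ))) := by
    ext A
    simp only [Finset.coe_biUnion, Set.mem_iUnion, Finset.mem_coe, Finset.mem_powerset]
    constructor
    · rintro ⟨M, hM, rfl⟩
      exact ⟨openers M, openers_subset, mem_matchingsAvoiding.1 hM⟩
    · rintro ⟨O, hO, hA⟩
      obtain ⟨M, hM, -, rfl⟩ := exists_arcs_eq_of_mem_diagrams hO hA
      exact ⟨M, hM, rfl⟩
  rw [← Set.ncard_image_of_injective _ arcs_injective, this, Set.ncard_coe_finset,
    Finset.card_biUnion, matchingCount]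
  · refine Finset.sum_congr rfl fun O hO => ?_
    rw [card_diagrams (m := 2 * n) (fun i hi => Finset.mem_range.1 (Finset.mem_powerset.1 hO hi))
      (fun j hj => Finset.mem_range.1 (Finset.sdiff_subset hj))]
    rfl
  -- A diagram determines its openers as its first coordinates.
  · intro O _ O' _ hne
    refine Finset.disjoint_left.2 fun A hA hA' => hne ?_
    rw [← (mem_diagrams.1 hA).1.image_fst, (mem_diagrams.1 hA').1.image_fst]

theorem ncard_matchingsOfShapeAvoiding {F : Finset (ℕ × ℕ)} (h : IsBoard n F) :
    (matchingsOfShapeAvoiding n F p123 p321).ncard =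
      if borderHeight n F < 5 then 2 ^ eta n F else 0 := by
  have h1 : matchingsOfShapeAvoiding n F p123 p321 =
      {M | M ∈ matchingsAvoiding n p123 p321 ∧ openers M = boardWord n F} := by
    ext M
    refine and_congr_right fun hM => ?_
    rw [hM.1.shape_eq]
    constructor
    · intro hF
      exact wordShape_injective openers_subset hM.1.card_openers boardWord_subset h.card_boardWord
        (hF.trans h.wordShape_boardWord.symm)
    · rintro hF
      rw [hF, h.wordShape_boardWord]
  rw [h1, ncard_matchings_of_openers boardWord_subset,
    card_diagrams_word (fun t ht => ?_) boardWord_subset h.card_boardWord, h.wordShape_boardWord]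
  rw [h.wordVertex_boardWord ht]
  exact h.border_above _ (h.boardPath_mem_border ht).1

end Matching

/-! ### Set partitions as arc diagrams -/

section Chains

variable {n : ℕ} {R : Fin n → Fin n → Prop}

theorem le_of_reflTransGen (hlt : ∀ i j, R i j → i < j) {i j : Fin n}
    (h : Relation.ReflTransGen R i j) : i ≤ j := by
  induction h with
  | refl => exact le_rfl
  | tail _ hab ih => exact ih.trans (hlt _ _ hab).le

/-- Lying on a common chain of arcs is an equivalence relation. -/
def chainSetoid (hr : Relator.RightUnique R) (hl : Relator.LeftUnique R) : Setoid (Fin n) where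
  r i j := Relation.ReflTransGen R i j ∨ Relation.ReflTransGen R j i
  iseqv := by
    refine ⟨fun i => Or.inl .refl, Or.symm, ?_⟩
    rintro i j k (hij | hji) (hjk | hkj)
    · exact Or.inl (hij.trans hjk)
    -- Two chains with a common last element are compared by walking backwards, using uniqueness of
    -- predecessors.
    · have hu : Relator.RightUnique (Function.swap R) := fun a b c hab hac => hl hab hac
      exact (Relation.ReflTransGen.total_of_right_unique hu (Relation.reflTransGen_swap.2 hij)
        (Relation.reflTransGen_swap.2 hkj)).symm.imp Relation.reflTransGen_swap.1
        Relation.reflTransGen_swap.1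
    · exact Relation.ReflTransGen.total_of_right_unique hr hji hjk
    · exact Or.inr (hkj.trans hji)

end Chains

section Partition

variable {n : ℕ} {P Q : Finpartition (Finset.univ : Finset (Fin n))}

theorem isArc_iff {i j : Fin n} :
    IsArc P i j ↔ i < j ∧ j ∈ P.part i ∧ ∀ l ∈ P.part i, ¬ (i < l ∧ l < j) := by
  refine and_congr_right fun _ => ⟨?_, ?_⟩
  · rintro ⟨B, hB, hi, hj, h⟩
    rw [P.part_eq_of_mem hB hi]
    exact ⟨hj, h⟩
  · rintro ⟨hj, h⟩
    exact ⟨_, P.part_mem.2 (Finset.mem_univ i), P.mem_part_self.2 (Finset.mem_univ i), hj, h⟩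

theorem mem_part_comm {i j : Fin n} : j ∈ P.part i ↔ i ∈ P.part j := by
  rw [P.mem_part_iff_part_eq_part (Finset.mem_univ _) (Finset.mem_univ _),
    P.mem_part_iff_part_eq_part (Finset.mem_univ _) (Finset.mem_univ _), eq_comm]

theorem part_eq_of_mem_part {i j : Fin n} (h : j ∈ P.part i) : P.part j = P.part i :=
  (P.mem_part_iff_part_eq_part (Finset.mem_univ _) (Finset.mem_univ _)).1 h

theorem isArc_rightUnique : Relator.RightUnique (IsArc P) := by
  intro i j k hj hk
  obtain ⟨h1, h2, h3⟩ := isArc_iff.1 hj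
  obtain ⟨h4, h5, h6⟩ := isArc_iff.1 hk
  have := h3 k h5
  have := h6 j h2
  omega

theorem isArc_leftUnique : Relator.LeftUnique (IsArc P) := by
  intro i j k hi hj
  obtain ⟨h1, h2, h3⟩ := isArc_iff.1 hi
  obtain ⟨h4, h5, h6⟩ := isArc_iff.1 hj
  have hij : P.part i = P.part j := (part_eq_of_mem_part h2).symm.trans (part_eq_of_mem_part h5)
  have hi : i ∈ P.part j := hij ▸ P.mem_part_self.2 (Finset.mem_univ i)
  have hj : j ∈ P.part i := hij ▸ P.mem_part_self.2 (Finset.mem_univ j)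
  have := h3 j hj
  have := h6 i hi
  omega

theorem part_eq_of_reflTransGen {i j : Fin n} (h : Relation.ReflTransGen (IsArc P) i j) :
    P.part j = P.part i := by
  induction h with
  | refl => rfl
  | tail _ hab ih => rw [← ih, part_eq_of_mem_part (isArc_iff.1 hab).2.1]

/-- The least element of the block above `i` is joined to `i` by an arc and is no further than `j`;
the distance to `j` has decreased. -/
theorem reflTransGen_of_mem_part {i j : Fin n} (hij : i ≤ j) (hj : j ∈ P.part i) :
    Relation.ReflTransGen (IsArc P) i j := by
  induction hd : (j : ℕ) - i using Nat.strong_induction_on generalizing i with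
  | _ d ih =>
    rcases hij.eq_or_lt with rfl | hlt
    · exact .refl
    · set S := (P.part i).filter (i < ·) with hS
      have hne : S.Nonempty := ⟨j, Finset.mem_filter.2 ⟨hj, hlt⟩⟩
      obtain ⟨hk, hik⟩ := Finset.mem_filter.1 (S.min'_mem hne)
      have hkj : S.min' hne ≤ j := S.min'_le _ (Finset.mem_filter.2 ⟨hj, hlt⟩)
      refine .head (isArc_iff.2 ⟨hik, hk, fun l hl hil => ?_⟩)
        (ih _ ?_ hkj (by rwa [part_eq_of_mem_part hk]) rfl)
      · exact (S.min'_le l (Finset.mem_filter.2 ⟨hl, hil.1⟩)).not_gt hil.2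
      · have : (i : ℕ) < S.min' hne := hik
        have : (S.min' hne : ℕ) ≤ j := hkj
        omega

theorem mem_part_iff {i j : Fin n} : j ∈ P.part i ↔
    Relation.ReflTransGen (IsArc P) i j ∨ Relation.ReflTransGen (IsArc P) j i := by
  constructor
  · intro h
    rcases le_total i j with hij | hji
    · exact Or.inl (reflTransGen_of_mem_part hij h)
    · exact Or.inr (reflTransGen_of_mem_part hji (mem_part_comm.1 h))
  · rintro (h | h)
    · rw [← part_eq_of_reflTransGen h]
      exact P.mem_part_self.2 (Finset.mem_univ j)
    · rw [part_eq_of_reflTransGen h]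
      exact P.mem_part_self.2 (Finset.mem_univ j)

theorem parts_subset_of_part_eq (h : ∀ i, P.part i = Q.part i) : P.parts ⊆ Q.parts := by
  intro B hB
  obtain ⟨i, hi⟩ := P.nonempty_of_mem_parts hB
  rw [← P.part_eq_of_mem hB hi, h]
  exact Q.part_mem.2 (Finset.mem_univ i)

theorem eq_of_isArc_eq (h : ∀ i j, IsArc P i j ↔ IsArc Q i j) : P = Q := by
  have hR : IsArc P = IsArc Q := by
    ext i j
    exact h i j
  have hpart : ∀ i, P.part i = Q.part i := fun i => by
    ext j
    rw [mem_part_iff, mem_part_iff, hR]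
  exact Finpartition.ext ((parts_subset_of_part_eq hpart).antisymm
    (parts_subset_of_part_eq fun i => (hpart i).symm))

/-- The blocks are the chains of `R`. Along a chain the points increase and successors are unique,
so consecutive elements of a block are exactly the related pairs. -/
theorem exists_finpartition_isArc_iff {R : Fin n → Fin n → Prop} (hlt : ∀ i j, R i j → i < j)
    (hr : Relator.RightUnique R) (hl : Relator.LeftUnique R) :
    ∃ P : Finpartition (Finset.univ : Finset (Fin n)), ∀ i j, IsArc P i j ↔ R i j := by
  classical
  refine ⟨Finpartition.ofSetoid (chainSetoid hr hl), fun i j => ?_⟩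
  rw [isArc_iff]
  simp only [Finpartition.mem_part_ofSetoid_iff_rel]
  have hrel : ∀ a b, chainSetoid hr hl a b ↔
    (Relation.ReflTransGen R a b ∨ Relation.ReflTransGen R b a) := fun _ _ => Iff.rfl
  simp only [hrel]
  constructor
  · rintro ⟨hij, h | h, hb⟩
    · rcases Relation.ReflTransGen.cases_head h with rfl | ⟨k, hik, hkj⟩
      · exact absurd hij (lt_irrefl _)
      · rcases (le_of_reflTransGen hlt hkj).eq_or_lt with rfl | hkj'
        · exact hik
        · exact absurd ⟨hlt _ _ hik, hkj'⟩ (hb k (Or.inl (.single hik)))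
    · exact absurd hij (le_of_reflTransGen hlt h).not_gt
  · intro hij
    refine ⟨hlt i j hij, Or.inl (.single hij), ?_⟩
    rintro l (h | h) ⟨hil, hlj⟩
    · rcases Relation.ReflTransGen.cases_head h with rfl | ⟨k, hik, hkl⟩
      · exact lt_irrefl _ hil
      · rw [← hr hij hik] at hkl
        exact (le_of_reflTransGen hlt hkl).not_gt hlj
    · exact (le_of_reflTransGen hlt h).not_gt hil

open Classical in
/-- The arcs of a set partition. -/
noncomputable def partitionArcs (P : Finpartition (Finset.univ : Finset (Fin n))) :
    Finset (Fin n × Fin n) :=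
  Finset.univ.filter fun e => IsArc P e.1 e.2

theorem mem_partitionArcs {i j : Fin n} : (i, j) ∈ partitionArcs P ↔ IsArc P i j := by
  simp [partitionArcs]

theorem partitionArcs_injective : Function.Injective (partitionArcs (n := n)) := by
  intro P Q h
  refine eq_of_isArc_eq fun i j => ?_
  rw [← mem_partitionArcs, h, mem_partitionArcs]

theorem isDiagram_partitionArcs : IsDiagram ((arcs (partitionArcs P)).image Prod.fst)
    ((arcs (partitionArcs P)).image Prod.snd) (arcs (partitionArcs P)) where
  mem i j hij := by
    refine ⟨Finset.mem_image_of_mem _ hij, Finset.mem_image_of_mem _ hij, ?_⟩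
    obtain ⟨_, _, h⟩ := mem_arcs.1 hij
    exact (mem_partitionArcs.1 h).1
  right i hi := by simpa using hi
  left j hj := by simpa using hj
  right_unique i j k hij hik := by
    obtain ⟨_, _, hij⟩ := mem_arcs.1 hij
    obtain ⟨_, _, hik⟩ := mem_arcs.1 hik
    simpa using isArc_rightUnique (mem_partitionArcs.1 hij) (mem_partitionArcs.1 hik)
  left_unique i j k hik hjk := by
    obtain ⟨_, _, hik⟩ := mem_arcs.1 hik
    obtain ⟨_, _, hjk⟩ := mem_arcs.1 hjk
    simpa using isArc_leftUnique (mem_partitionArcs.1 hik) (mem_partitionArcs.1 hjk)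

theorem strictMono_vec_six {a b c d e f : Fin n} (hab : a < b) (hbc : b < c) (hcd : c < d)
    (hde : d < e) (hef : e < f) : StrictMono (![a, b, c, d, e, f] : Fin (3 + 3) → Fin n) := by
  rw [Fin.strictMono_iff_lt_succ (n := 5)]
  intro i
  fin_cases i <;> assumption

/-- The pattern 123 joins the six points as 1-6, 2-5, 3-4, a nesting; the pattern 321 joins them as
1-4, 2-5, 3-6, a crossing. -/
theorem isSparse_partitionArcs_iff :
    IsSparse (arcs (partitionArcs P)) ↔ PartitionAvoids P p123 ∧ PartitionAvoids P p321 := by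
  constructor
  · rintro ⟨h1, h2⟩
    refine ⟨?_, ?_⟩
    · rintro ⟨i, hi, h⟩
      exact h2 (i 0) (i 1) (i 2) (i 3) (i 4) (i 5) (hi (by decide)) (hi (by decide))
        (hi (by decide)) (hi (by decide)) (hi (by decide))
        (val_mem_arcs.2 (mem_partitionArcs.2 (h 0)))
        (val_mem_arcs.2 (mem_partitionArcs.2 (h 1)))
        (val_mem_arcs.2 (mem_partitionArcs.2 (h 2)))
    · rintro ⟨i, hi, h⟩
      exact h1 (i 0) (i 1) (i 2) (i 3) (i 4) (i 5) (hi (by decide)) (hi (by decide))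
        (hi (by decide)) (hi (by decide)) (hi (by decide))
        (val_mem_arcs.2 (mem_partitionArcs.2 (h 0)))
        (val_mem_arcs.2 (mem_partitionArcs.2 (h 1)))
        (val_mem_arcs.2 (mem_partitionArcs.2 (h 2)))
  · rintro ⟨h1, h2⟩
    refine ⟨fun i₁ i₂ i₃ j₁ j₂ j₃ a b c d e f g k => h2 ?_,
      fun i₁ i₂ i₃ j₁ j₂ j₃ a b c d e f g k => h1 ?_⟩
    all_goals
      obtain ⟨_, _, f⟩ := mem_arcs.1 f
      obtain ⟨_, _, g⟩ := mem_arcs.1 g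
      obtain ⟨_, _, k⟩ := mem_arcs.1 k
      refine ⟨![⟨i₁, ‹_›⟩, ⟨i₂, ‹_›⟩, ⟨i₃, ‹_›⟩, ⟨j₁, ‹_›⟩, ⟨j₂, ‹_›⟩, ⟨j₃, ‹_›⟩],
        strictMono_vec_six a b c d e, fun x => ?_⟩
      fin_cases x
      · exact mem_partitionArcs.1 f
      · exact mem_partitionArcs.1 g
      · exact mem_partitionArcs.1 k

theorem ncard_partitionsAvoiding (n : ℕ) :
    (partitionsAvoiding n p123 p321).ncard = partitionCount n 0 := by
  classical
  have himage : (fun P => arcs (partitionArcs P)) '' partitionsAvoiding n p123 p321 =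
      (((Finset.range n).powerset ×ˢ (Finset.range n).powerset).biUnion
        fun p => diagrams p.1 p.2 : Finset (Finset (ℕ × ℕ))) := by
    ext A
    simp only [Finset.coe_biUnion, Set.mem_iUnion, Finset.mem_coe, Finset.mem_product,
      Finset.mem_powerset]
    constructor
    · rintro ⟨P, hP, rfl⟩
      refine ⟨(_, _), ⟨?_, ?_⟩,
        mem_diagrams.2 ⟨isDiagram_partitionArcs, isSparse_partitionArcs_iff.2 hP⟩⟩
      · exact Finset.image_subset_iff.2 fun p hp => Finset.mem_range.2 (mem_arcs.1 hp).1
      · exact Finset.image_subset_iff.2 fun p hp => Finset.mem_range.2 (mem_arcs.1 hp).2.1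
    · rintro ⟨⟨O, C⟩, ⟨hO, hC⟩, hA⟩
      obtain ⟨h, hs⟩ := mem_diagrams.1 hA
      obtain ⟨M, rfl⟩ := exists_arcs_eq (m := n) (A := A) fun i j hij =>
        ⟨Finset.mem_range.1 (hO (h.mem i j hij).1), Finset.mem_range.1 (hC (h.mem i j hij).2.1)⟩
      obtain ⟨P, hP⟩ := exists_finpartition_isArc_iff (R := fun i j => (i, j) ∈ M)
        (fun i j hij => (h.mem _ _ (val_mem_arcs.2 hij)).2.2)
        (fun i j k hij hik => Fin.ext
          (h.right_unique _ _ _ (val_mem_arcs.2 hij) (val_mem_arcs.2 hik)))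
        (fun i j k hik hjk => Fin.ext
          (h.left_unique _ _ _ (val_mem_arcs.2 hik) (val_mem_arcs.2 hjk)))
      have hM : partitionArcs P = M := by
        ext ⟨i, j⟩
        rw [mem_partitionArcs, hP]
      exact ⟨P, isSparse_partitionArcs_iff.1 (by rwa [hM]), by simp only [hM]⟩
  rw [← Set.ncard_image_of_injective _ (arcs_injective.comp partitionArcs_injective)]
  change ((fun P => arcs (partitionArcs P)) '' partitionsAvoiding n p123 p321).ncard = _
  rw [himage, Set.ncard_coe_finset, Finset.card_biUnion, partitionCount, Finset.sum_product]
  · refine Finset.sum_congr rfl fun O hO => Finset.sum_congr rfl fun C hC => ?_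
    rw [card_diagrams (m := n) (fun i hi => Finset.mem_range.1 (Finset.mem_powerset.1 hO hi))
      (fun j hj => Finset.mem_range.1 (Finset.mem_powerset.1 hC hj))]
    rfl
  · intro p _ q _ hne
    refine Finset.disjoint_left.2 fun A hA hA' => hne ?_
    have h1 := (mem_diagrams.1 hA).1
    have h2 := (mem_diagrams.1 hA').1
    exact Prod.ext (h1.image_fst.symm.trans h2.image_fst) (h1.image_snd.symm.trans h2.image_snd)

end Partition

end FerrersMatching

theorem mainTheorem7 :
    (∀ (n : ℕ) (F : Finset (ℕ × ℕ)), FerrersMatching.IsBoard n F →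
      (FerrersMatching.matchingsOfShapeAvoiding n F
          FerrersMatching.p123 FerrersMatching.p321).ncard =
        if FerrersMatching.borderHeight n F < 5 then 2 ^ FerrersMatching.eta n F else 0) ∧
    (PowerSeries.mk (fun n : ℕ => ((FerrersMatching.matchingsAvoiding n
          FerrersMatching.p123 FerrersMatching.p321).ncard : ℚ)) =
      (1 - 5 * PowerSeries.X + 2 * PowerSeries.X ^ 2) *
        (1 - 6 * PowerSeries.X + 5 * PowerSeries.X ^ 2)⁻¹) ∧
    (∀ n : ℕ, 1 ≤ n →
      ((FerrersMatching.matchingsAvoiding n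
          FerrersMatching.p123 FerrersMatching.p321).ncard : ℚ) = (5 ^ (n - 1) + 1) / 2) ∧
    (PowerSeries.mk (fun n : ℕ => ((FerrersMatching.partitionsAvoiding n
          FerrersMatching.p123 FerrersMatching.p321).ncard : ℚ)) =
      (1 - 10 * PowerSeries.X + 32 * PowerSeries.X ^ 2 - 37 * PowerSeries.X ^ 3
          + 12 * PowerSeries.X ^ 4) *
        ((1 - PowerSeries.X) *
          (1 - 10 * PowerSeries.X + 31 * PowerSeries.X ^ 2 - 30 * PowerSeries.X ^ 3
            + PowerSeries.X ^ 4))⁻¹) := by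
  simp only [FerrersMatching.ncard_matchingsAvoiding, FerrersMatching.ncard_partitionsAvoiding]
  refine ⟨fun n F hF => FerrersMatching.ncard_matchingsOfShapeAvoiding hF,
    FerrersMatching.mk_matchingCount, fun n hn => ?_, FerrersMatching.mk_partitionCount⟩
  obtain ⟨m, rfl⟩ : ∃ m, n = m + 1 := ⟨n - 1, by omega⟩
  have h := congrArg (Nat.cast (R := ℚ)) (FerrersMatching.matchingCount_two_mul m).1
  push_cast at h
  rw [Nat.add_sub_cancel]
  linarith
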